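/- **Setting.** Let $X$ be a measurable space with a reference measure $\mu$ (for instance a subset of $\mathbb R^d$ with Lebesgue or counting measure). For $\theta\in\mathbb R^n$ let $\pi_\theta>0$ be a measurable probability density on $X$ with respect to $\mu$, let $\mathcal R_\theta:X\to\mathbb R$ be measurable, and let $\mathcal G:\mathbb R^n\to\mathbb R\cup\{+\infty\}$ be closed, proper and convex. Put $\mathcal J(\theta)=\mathbb E_{x\sim\pi_\theta}[\mathcal R_\theta(x)]$ and $\mathcal F=\mathcal J-\mathcal G$, and assume that $\mathcal F^*=\sup_\theta\mathcal F(\theta)$ is finite and attained. Let $U,C_g,C_h,\widetilde C_g,\widetilde C_h,C_w>0$ be such that, for all $x\in X$ and $\theta,\theta'\in\mathbb R^n$: 1. $|\mathcal R_\theta(x)|\le U$, the map $\theta\mapsto\mathcal R_\theta(x)$ is $C^2$, $\|\nabla_\theta\mathcal R_\theta(x)\|\le\widetilde C_g$ and $\|\nabla^2_\theta\mathcal R_\theta(x)\|_2\le\widetilde C_h$; 2. $\theta\mapsto\log\pi_\theta(x)$ is twice differentiable, $\|\nabla_\theta\log\pi_\theta(x)\|\le C_g$ and $\|\nabla^2_\theta\log\pi_\theta(x)\|_2\le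 C_h$; 3. $\mathbb E_{x\sim\pi_{\theta'}}\big[(\pi_\theta(x)/\pi_{\theta'}(x)-1)^2\big]\le C_w^2$. Set $L=U(C_g^2+C_h)+\widetilde C_h+2C_g\widetilde C_g$ and $$C=6U^2C_h^2+6C_g^2\widetilde C_g^2+6\widetilde C_h^2+(4U^2C_g^2+4\widetilde C_g^2)(2C_g^2+C_h)(C_w^2+1).$$ **Algorithm (PAGE).** Let $g(x,\theta)=\mathcal R_\theta(x)\nabla_\theta\log\pi_\theta(x)+\nabla_\theta\mathcal R_\theta(x)$ and $g_w(x,\theta,\theta')=\frac{\pi_\theta(x)}{\pi_{\theta'}(x)}g(x,\theta)$. Given $\theta^0$, $N_1,N_2,T\in\mathbb N$, $p\in(0,1]$ and $\eta>0$, let $g^0=\frac1{N_1}\sum_{j=1}^{N_1}g(x^{0,j},\theta^0)$ with $x^{0,j}$ i.i.d. from $\pi_{\theta^0}$. For $t=0,\dots,T-1$ put $$\theta^{t+1}=\mathrm{Prox}_{\eta\mathcal G}(\theta^t+\eta g^t),\qquad \mathrm{Prox}_{\eta\mathcal G}(\theta)=\operatorname*{argmin}_{\theta'}\Big\{\mathcal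 G(\theta')+\tfrac1{2\eta}\|\theta'-\theta\|^2\Big\},$$ draw fresh i.i.d. samples $x^{t+1,j}\sim\pi_{\theta^{t+1}}$, and set $$g^{t+1}=\begin{cases}\frac1{N_1}\sum_{j=1}^{N_1}g(x^{t+1,j},\theta^{t+1}) & \text{with probability }p,\\[2pt] \frac1{N_2}\sum_{j=1}^{N_2}g(x^{t+1,j},\theta^{t+1})-\frac1{N_2}\sum_{j=1}^{N_2}g_w(x^{t+1,j},\theta^t,\theta^{t+1})+g^t & \text{with probability }1-p.\end{cases}$$ The output $\hat\theta^T$ is $\theta^t$ for an independent, uniformly random index $t\in\{1,\dots,T\}$. The sample complexity is the expected total number of samples drawn: $N_1$ at the start, then $N_1$ or $N_2$ per iteration according to the branch taken. **Theorem.** Let $\Delta>0$ and $0<\eta\le L/(2C+2L^2)$. There are constants $a,b>0$ such that for all $\alpha\ge a$ and $\beta\ge b$ there is a constant $c>0$, where $a,b$ depend only on $U,C_g,C_h,\widetilde C_g,\widetilde C_h,C_w,\eta,\Delta$, and $c$ only on these and on $\alpha,\beta$, with the following property. For every problem as above and every $\theta^0$ with $\mathcal F^*-\mathcal F(\theta^0)\le\Delta$,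 the function $\mathcal J$ is differentiable, and for every $\epsilon\in(0,1)$ the algorithm run with $$N_2=\lceil\alpha/\epsilon\rceil,\qquad N_1=N_2^2=O(\epsilon^{-2}),\qquad p=\frac{N_2}{N_1+N_2},\qquad T=\lceil\beta/\epsilon^2\rceil=O(\epsilon^{-2})$$ has a well-defined output law, and its output is an expected $\epsilon$-stationary point: $$\mathbb E\Big[\mathrm{dist}\big(0,-\nabla\mathcal J(\hat\theta^T)+\partial\mathcal G(\hat\theta^T)\big)^2\Big]\le\epsilon^2 .$$ Here $\partial\mathcal G$ is the convex subdifferential and the distance to the empty set is $+\infty$. Moreover, the expected total number of samples drawn is at most $c\,\epsilon^{-3}$. -/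

import Mathlib

open MeasureTheory
open scoped ENNReal

/-- The data of a regularized expected reward problem
`max_θ 𝔼_{x ∼ π_θ} [R_θ(x)] - G(θ)` over `θ ∈ ℝⁿ`: a reference measure on the sample space `X`
(Lebesgue measure on a subset of `ℝᵈ`, a counting measure, ...), the density `π_θ(x)` of the policy
with respect to it, the reward `R_θ(x)` and the extended-real-valued regularizer `G`. -/
structure RewardProblem (n : ℕ) (X : Type*) [MeasurableSpace X] where
  refMeasure : Measure X
  density : EuclideanSpace ℝ (Fin n) → X → ℝ
  reward : EuclideanSpace ℝ (Fin n) → X → ℝ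
  regularizer : EuclideanSpace ℝ (Fin n) → EReal

namespace RewardProblem

noncomputable section

variable {n : ℕ} {X : Type*} [MeasurableSpace X] (M : RewardProblem n X)

/-- The probability distribution `π_θ`. -/
def policy (θ : EuclideanSpace ℝ (Fin n)) : Measure X :=
  M.refMeasure.withDensity fun x => ENNReal.ofReal (M.density θ x)

/-- The expected reward `J(θ) = 𝔼_{x ∼ π_θ} [R_θ(x)]`. -/
def expectedReward (θ : EuclideanSpace ℝ (Fin n)) : ℝ :=
  ∫ x, M.reward θ x ∂M.policy θ

/-- The objective `F(θ) = J(θ) - G(θ)`, with value `-∞` outside the domain of `G`. -/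
def objective (θ : EuclideanSpace ℝ (Fin n)) : EReal :=
  (M.expectedReward θ : EReal) - M.regularizer θ

/-- The optimal value `F*`. -/
def optimalValue : EReal := ⨆ θ, M.objective θ

/-- The standing assumptions: `π_θ` is a probability distribution with a positive measurable
density, the reward is measurable in `x`, `G` is a closed proper convex function, and the optimal
value is finite and attained. -/
structure WellPosed : Prop where
  density_pos : ∀ θ x, 0 < M.density θ x
  density_measurable : ∀ θ, Measurable (M.density θ)
  policy_prob : ∀ θ, IsProbabilityMeasure (M.policy θ)
  reward_measurable : ∀ θ, Measurable (M.reward θ)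
  regularizer_ne_bot : ∀ θ, M.regularizer θ ≠ ⊥
  regularizer_proper : ∃ θ, M.regularizer θ ≠ ⊤
  regularizer_closed : LowerSemicontinuous M.regularizer
  regularizer_convex :
    Convex ℝ {q : EuclideanSpace ℝ (Fin n) × ℝ | M.regularizer q.1 ≤ (q.2 : EReal)}
  optimalValue_finite : M.optimalValue ≠ ⊥ ∧ M.optimalValue ≠ ⊤
  optimalValue_attained : ∃ θ, M.objective θ = M.optimalValue

/-- `∇_θ R_θ(x)`. -/
def rewardGrad (x : X) (θ : EuclideanSpace ℝ (Fin n)) : EuclideanSpace ℝ (Fin n) :=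
  gradient (fun ϑ => M.reward ϑ x) θ

/-- The score `∇_θ log π_θ(x)`. -/
def score (x : X) (θ : EuclideanSpace ℝ (Fin n)) : EuclideanSpace ℝ (Fin n) :=
  gradient (fun ϑ => Real.log (M.density ϑ x)) θ

/-- The rewards are bounded by `U` and `C²` in `θ`, with gradients bounded by `Dg` and Hessians
bounded by `Dh` in spectral norm. -/
structure BoundedReward (U Dg Dh : ℝ) : Prop where
  abs_le : ∀ θ x, |M.reward θ x| ≤ U
  contDiff : ∀ x, ContDiff ℝ 2 fun θ => M.reward θ x
  grad_le : ∀ θ x, ‖M.rewardGrad x θ‖ ≤ Dg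
  hessian_le : ∀ θ x, ‖fderiv ℝ (M.rewardGrad x) θ‖ ≤ Dh

/-- `log π_θ(x)` is twice differentiable in `θ`, with gradients bounded by `Cg` and Hessians
bounded by `Ch` in spectral norm. -/
structure BoundedScore (Cg Ch : ℝ) : Prop where
  differentiable : ∀ x, Differentiable ℝ fun θ => Real.log (M.density θ x)
  score_differentiable : ∀ x, Differentiable ℝ (M.score x)
  score_le : ∀ θ x, ‖M.score x θ‖ ≤ Cg
  hessian_le : ∀ θ x, ‖fderiv ℝ (M.score x) θ‖ ≤ Ch

/-- The importance weight `π_θ(x) / π_θ'(x)`. -/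
def importanceWeight (x : X) (θ θ' : EuclideanSpace ℝ (Fin n)) : ℝ :=
  M.density θ x / M.density θ' x

/-- The importance weights have variance at most `Cw²`, uniformly in both parameters. -/
def BoundedImportanceWeight (Cw : ℝ) : Prop :=
  ∀ θ θ', ∫⁻ x, ENNReal.ofReal ((M.importanceWeight x θ θ' - 1) ^ 2) ∂M.policy θ' ≤
    ENNReal.ofReal (Cw ^ 2)

/-- The convex subdifferential `∂G(θ)`. -/
def subdifferential (θ : EuclideanSpace ℝ (Fin n)) : Set (EuclideanSpace ℝ (Fin n)) :=
  {v | ∀ θ', M.regularizer θ + ((inner ℝ v (θ' - θ) : ℝ) : EReal) ≤ M.regularizer θ'}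

/-- `dist(0, -∇J(θ) + ∂G(θ))`, which is `∞` if `∂G(θ)` is empty. -/
def stationarityGap (θ : EuclideanSpace ℝ (Fin n)) : ℝ≥0∞ :=
  Metric.infEDist 0 ((fun v => -gradient M.expectedReward θ + v) '' M.subdifferential θ)

/-- `Prox_{ηG}(θ)`, a minimizer of `θ' ↦ G(θ') + ‖θ' - θ‖² / (2η)`. -/
def prox (η : ℝ) (θ : EuclideanSpace ℝ (Fin n)) : EuclideanSpace ℝ (Fin n) :=
  Classical.epsilon fun y => ∀ z,
    M.regularizer y + ((‖y - θ‖ ^ 2 / (2 * η) : ℝ) : EReal) ≤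
      M.regularizer z + ((‖z - θ‖ ^ 2 / (2 * η) : ℝ) : EReal)

/-- `g(x, θ) = R_θ(x) ∇_θ log π_θ(x) + ∇_θ R_θ(x)`. -/
def sampleGrad (x : X) (θ : EuclideanSpace ℝ (Fin n)) : EuclideanSpace ℝ (Fin n) :=
  M.reward θ x • M.score x θ + M.rewardGrad x θ

/-- `g_w(x, θ, θ') = (π_θ(x) / π_θ'(x)) g(x, θ)`. -/
def weightedGrad (x : X) (θ θ' : EuclideanSpace ℝ (Fin n)) : EuclideanSpace ℝ (Fin n) :=
  M.importanceWeight x θ θ' • M.sampleGrad x θ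

/-- The law of `N` independent samples from `π_θ`. -/
def batchLaw (N : ℕ) (θ : EuclideanSpace ℝ (Fin n)) : Measure (Fin N → X) :=
  Measure.pi fun _ => M.policy θ

/-- The mini-batch estimator `(1/N) ∑ⱼ g(xⱼ, θ)`. -/
def fullEstimator {N : ℕ} (x : Fin N → X) (θ : EuclideanSpace ℝ (Fin n)) :
    EuclideanSpace ℝ (Fin n) :=
  (N : ℝ)⁻¹ • ∑ j, M.sampleGrad (x j) θ

/-- The recursive estimator
`(1/N) ∑ⱼ g(xⱼ, θnew) - (1/N) ∑ⱼ g_w(xⱼ, θold, θnew) + g`. -/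
def recursiveEstimator {N : ℕ} (x : Fin N → X) (θold θnew g : EuclideanSpace ℝ (Fin n)) :
    EuclideanSpace ℝ (Fin n) :=
  (N : ℝ)⁻¹ • ∑ j, M.sampleGrad (x j) θnew
    - (N : ℝ)⁻¹ • ∑ j, M.weightedGrad (x j) θold θnew + g

/-- The state of the PAGE method after `t` iterations: the current iterate `θᵗ`, the current
gradient estimator `gᵗ`, and the number of samples drawn so far. -/
abbrev State (n : ℕ) : Type :=
  EuclideanSpace ℝ (Fin n) × EuclideanSpace ℝ (Fin n) × ℕ

/-- The law of the initial state, where `g⁰` is computed from `N₁` samples. -/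
def initLaw (N₁ : ℕ) (θ₀ : EuclideanSpace ℝ (Fin n)) : Measure (State n) :=
  (M.batchLaw N₁ θ₀).map fun x => (θ₀, M.fullEstimator x θ₀, N₁)

/-- One iteration of the PAGE method, as the law of the next state given the current one: the
iterate moves to `θ' = Prox_{ηG}(θ + η g)`; with probability `p` the estimator is recomputed from
`N₁` samples of `π_θ'`, and with probability `1 - p` it is updated from `N₂` such samples. -/
def pageStep (N₁ N₂ : ℕ) (p η : ℝ) (s : State n) : Measure (State n) :=
  let θ' := M.prox η (s.1 + η • s.2.1)
  ENNReal.ofReal p • (M.batchLaw N₁ θ').map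
      (fun x => (θ', M.fullEstimator x θ', s.2.2 + N₁)) +
    ENNReal.ofReal (1 - p) • (M.batchLaw N₂ θ').map
      (fun x => (θ', M.recursiveEstimator x s.1 θ' s.2.1, s.2.2 + N₂))

/-- The law of the state of the PAGE method after `t` iterations. -/
def stateLaw (N₁ N₂ : ℕ) (p η : ℝ) (θ₀ : EuclideanSpace ℝ (Fin n)) : ℕ → Measure (State n)
  | 0 => M.initLaw N₁ θ₀
  | t + 1 => (stateLaw N₁ N₂ p η θ₀ t).bind (M.pageStep N₁ N₂ p η)

/-- The law of the output of the PAGE method after `T` iterations, an iterate `θᵗ` whose index `t`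
is uniformly distributed on `{1, ..., T}` and independent of the iterates. -/
def outputLaw (N₁ N₂ : ℕ) (p η : ℝ) (θ₀ : EuclideanSpace ℝ (Fin n)) (T : ℕ) :
    Measure (EuclideanSpace ℝ (Fin n)) :=
  (T : ℝ≥0∞)⁻¹ • ∑ t ∈ Finset.Icc 1 T, (M.stateLaw N₁ N₂ p η θ₀ t).map Prod.fst

/-- The expected total number of samples drawn in `T` iterations of the PAGE method. -/
def expectedSamples (N₁ N₂ : ℕ) (p η : ℝ) (θ₀ : EuclideanSpace ℝ (Fin n)) (T : ℕ) : ℝ≥0∞ :=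
  ∫⁻ s, (s.2.2 : ℝ≥0∞) ∂M.stateLaw N₁ N₂ p η θ₀ T

/-- The constant `L = U (Cg² + Ch) + Dh + 2 Cg Dg`. -/
def constL (U Cg Ch Dg Dh : ℝ) : ℝ :=
  U * (Cg ^ 2 + Ch) + Dh + 2 * Cg * Dg

/-- The constant
`C = 6 U² Ch² + 6 Cg² Dg² + 6 Dh² + (4 U² Cg² + 4 Dg²) (2 Cg² + Ch) (Cw² + 1)`. -/
def constC (U Cg Ch Dg Dh Cw : ℝ) : ℝ :=
  6 * U ^ 2 * Ch ^ 2 + 6 * Cg ^ 2 * Dg ^ 2 + 6 * Dh ^ 2 +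
    (4 * U ^ 2 * Cg ^ 2 + 4 * Dg ^ 2) * (2 * Cg ^ 2 + Ch) * (Cw ^ 2 + 1)

end

end RewardProblem

/-!
The PAGE method works because its gradient estimator `gᵗ` tracks `∇J(θᵗ)` with an error that is paid
for by the length of the proximal steps, while the proximal steps decrease `F* - F` by an amount
that is quadratic in their length.

*Smoothness.* The bound on the score makes `θ ↦ log π_θ(x)` Lipschitz, hence
`|π_θ / π_θ' - 1| ≤ Cg ‖θ - θ'‖ exp (Cg ‖θ - θ'‖)` pointwise. Subdividing the segment from `θ'` to
`θ` removes the exponential factor in every `Lᵖ` norm (`le_ofReal_mul_norm_sub_of_triangle`,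
`eLpNorm_importanceWeight_sub_one_le`). Writing
`g_w(x, θ, θ') - g(x, θ') = (g(x, θ) - g(x, θ')) + (π_θ / π_θ' - 1) g(x, θ)`, the case `p = 1` shows
that `∇J(θ) = 𝔼 g(x, θ)` is Lipschitz with constant `L` (`norm_gradient_expectedReward_sub_le`), and
the case `p = 2` bounds the second moment of this difference by `C ‖θ - θ'‖²`
(`integral_sq_norm_weightedGrad_sub_sampleGrad_le`). No second derivative of `J` is needed.

*One iteration.* A restart has mean squared error at most `σ² / N₁` with `σ = U Cg + Dg`, and since
the increments of the recursive estimator are unbiased and independent, a recursive update adds at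
most `C ‖θᵗ⁺¹ - θᵗ‖² / N₂` to the squared error (`meanSqError_succ_le`). The proximal step satisfies
`F* - F(θᵗ⁺¹) + (1/η - L) ‖θᵗ⁺¹ - θᵗ‖² ≤ F* - F(θᵗ) + ‖gᵗ - ∇J(θᵗ)‖² / (2L)`
(`suboptimality_prox_add_le`), and its optimality condition bounds the stationarity gap at `θᵗ⁺¹` by
the error of `gᵗ` and the step length (`stationarityGap_prox_sq_le`).

*Summation.* For `N₁ = N₂²` and `p = 1 / (N₂ + 1)` the accumulated error is at most `C` times the
accumulated squared step length plus `σ² ((N₂ + 1) + T) / N₂²`, and the condition on `η` lets the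
descent absorb the first term (`sum_le_of_error_and_descent_recursion`). Hence the mean squared gap
of the output is `O(1 / T + 1 / N₂²)`.

Expectations over the states of the method are lower integrals of `ℝ≥0∞`-valued functions, so the
stationarity gap need not be measurable. The transition `pageStep` must be: this holds because
`π_θ(x)` and `g(x, θ)` are continuous in `θ` and measurable in `x`, and the proximal map is
nonexpansive (`measurable_pageStep`).
-/

/-! ### Lipschitz bounds and gradients -/

/-- A distance-like function on a normed space that satisfies `D x y ≤ K ‖x - y‖ e^{c‖x - y‖}` and
the triangle inequality satisfies the bound without the exponential factor: subdivide the segment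
from `x` to `y` into ever smaller pieces. -/
theorem le_ofReal_mul_norm_sub_of_triangle {E : Type*} [NormedAddCommGroup E] [NormedSpace ℝ E]
    {D : E → E → ℝ≥0∞} {K c : ℝ} (htri : ∀ x y z, D x z ≤ D x y + D y z)
    (hloc : ∀ x y, D x y ≤ ENNReal.ofReal (K * ‖x - y‖ * Real.exp (c * ‖x - y‖))) (x y : E) :
    D x y ≤ ENNReal.ofReal (K * ‖x - y‖) := by
  have hself : ∀ x, D x x = 0 := fun x => by simpa using hloc x x
  have key : ∀ N : ℕ, D x y ≤
      ENNReal.ofReal (K * ‖x - y‖ * Real.exp (c * ‖x - y‖ * (1 / ((N : ℝ) + 1)))) := by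
    intro N
    set r := ‖x - y‖ with hr
    have hN : (0 : ℝ) < (N : ℝ) + 1 := by positivity
    set z : ℕ → E := fun k => x + ((k : ℝ) / ((N : ℝ) + 1)) • (y - x) with hz
    have hstep : ∀ k, ‖z k - z (k + 1)‖ = r / ((N : ℝ) + 1) := by
      intro k
      have h1 : z k - z (k + 1) = (1 / ((N : ℝ) + 1)) • (x - y) := by
        simp only [hz, Nat.cast_add, Nat.cast_one, add_div, add_smul, smul_sub]
        abel
      rw [h1, norm_smul, Real.norm_of_nonneg (by positivity)]
      ring
    set δ := ENNReal.ofReal (K * (r / ((N : ℝ) + 1)) * Real.exp (c * (r / ((N : ℝ) + 1)))) with hδ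
    have hind : ∀ k : ℕ, D x (z k) ≤ k * δ := by
      intro k
      induction k with
      | zero => simp [hz, hself]
      | succ k ih =>
        calc D x (z (k + 1)) ≤ D x (z k) + D (z k) (z (k + 1)) := htri _ _ _
          _ ≤ k * δ + δ := by
            refine add_le_add ih ?_
            have := hloc (z k) (z (k + 1))
            rwa [hstep] at this
          _ = ((k + 1 : ℕ) : ℝ≥0∞) * δ := by push_cast; ring
    have hend : z (N + 1) = y := by
      simp only [hz, Nat.cast_add, Nat.cast_one, div_self hN.ne', one_smul]
      abel
    have := hind (N + 1)
    rw [hend, hδ, ← ENNReal.ofReal_natCast, ← ENNReal.ofReal_mul (by positivity)] at this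
    convert this using 2
    push_cast
    field_simp
  refine ge_of_tendsto' (x := Filter.atTop) ?_ key
  refine ENNReal.tendsto_ofReal ?_
  have h0 := tendsto_one_div_add_atTop_nhds_zero_nat (𝕜 := ℝ)
  have := (Real.continuous_exp.tendsto _).comp (h0.const_mul (c * ‖x - y‖))
  simpa using this.const_mul (K * ‖x - y‖)

theorem abs_exp_sub_one_le_mul_exp {u r : ℝ} (h : |u| ≤ r) :
    |Real.exp u - 1| ≤ r * Real.exp r := by
  have hr : 0 ≤ r := (abs_nonneg u).trans h
  have h1 : 1 ≤ Real.exp r := Real.one_le_exp hr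
  rw [abs_le] at h ⊢
  constructor
  · nlinarith [Real.add_one_le_exp u]
  · have h2 : Real.exp u ≤ Real.exp r := Real.exp_le_exp.2 h.2
    have h3 : Real.exp r * Real.exp (-r) = 1 := by rw [← Real.exp_add]; simp
    nlinarith [Real.add_one_le_exp (-r), Real.exp_pos r]

section Gradient

variable {F : Type*} [NormedAddCommGroup F] [InnerProductSpace ℝ F]

theorem norm_sub_le_of_norm_fderiv_le {G : Type*} [NormedAddCommGroup G] [NormedSpace ℝ G]
    {f : F → G} {K : ℝ} (hf : Differentiable ℝ f) (hK : ∀ a, ‖fderiv ℝ f a‖ ≤ K) (a b : F) :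
    ‖f a - f b‖ ≤ K * ‖a - b‖ :=
  convex_univ.norm_image_sub_le_of_norm_fderiv_le (fun x _ => hf x) (fun x _ => hK x)
    (Set.mem_univ b) (Set.mem_univ a)

variable [CompleteSpace F]

theorem norm_fderiv_eq_norm_gradient (f : F → ℝ) (a : F) : ‖fderiv ℝ f a‖ = ‖gradient f a‖ := by
  rw [gradient, LinearIsometryEquiv.norm_map]

theorem abs_sub_le_of_norm_gradient_le {f : F → ℝ} {K : ℝ} (hf : Differentiable ℝ f)
    (hK : ∀ a, ‖gradient f a‖ ≤ K) (a b : F) : |f a - f b| ≤ K * ‖a - b‖ :=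
  norm_sub_le_of_norm_fderiv_le hf (fun a => (norm_fderiv_eq_norm_gradient f a).trans_le (hK a)) a b

end Gradient

/-- The gradient of a family of differentiable functions, each value of which is measurable in the
parameter, is measurable in the parameter: its coordinates are limits of difference quotients. -/
theorem measurable_gradient_of_measurable {n : ℕ} {X : Type*} [MeasurableSpace X]
    {f : EuclideanSpace ℝ (Fin n) → X → ℝ} (hf : ∀ θ, Measurable (f θ))
    (hd : ∀ x, Differentiable ℝ fun θ => f θ x) (θ : EuclideanSpace ℝ (Fin n)) :
    Measurable fun x => gradient (fun ϑ => f ϑ x) θ := by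
  have hcoord : ∀ i, Measurable fun x => (gradient (fun ϑ => f ϑ x) θ) i := by
    intro i
    set e : EuclideanSpace ℝ (Fin n) := EuclideanSpace.single i (1 : ℝ) with he
    have hi : ∀ x, (gradient (fun ϑ => f ϑ x) θ) i = fderiv ℝ (fun ϑ => f ϑ x) θ e := by
      intro x
      rw [← inner_gradient_left, he, EuclideanSpace.inner_single_right]
      simp
    simp only [hi]
    refine measurable_of_tendsto_metrizable
      (f := fun (k : ℕ) x => ((k : ℝ) + 1) * (f (θ + ((k : ℝ) + 1)⁻¹ • e) x - f θ x)) ?_ ?_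
    · intro k
      exact ((hf _).sub (hf _)).const_mul _
    · rw [tendsto_pi_nhds]
      intro x
      have hc : Filter.Tendsto (fun k : ℕ => ‖(k : ℝ) + 1‖) Filter.atTop Filter.atTop :=
        tendsto_norm_atTop_atTop.comp
          (Filter.tendsto_atTop_add_const_right _ _ tendsto_natCast_atTop_atTop)
      exact (hd x θ).hasFDerivAt.lim e hc
  have := (MeasurableEquiv.toLp 2 (Fin n → ℝ)).measurable.comp (measurable_pi_lambda _ hcoord)
  exact this

/-! ### Importance weights -/

namespace RewardProblem

variable {n : ℕ} {X : Type*} [MeasurableSpace X] {M : RewardProblem n X}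
  {U Cg Ch Dg Dh Cw : ℝ}

theorem importanceWeight_pos (hM : M.WellPosed) (x : X) (θ θ' : EuclideanSpace ℝ (Fin n)) :
    0 < M.importanceWeight x θ θ' :=
  div_pos (hM.density_pos _ _) (hM.density_pos _ _)

theorem measurable_importanceWeight (hM : M.WellPosed) (θ θ' : EuclideanSpace ℝ (Fin n)) :
    Measurable fun x => M.importanceWeight x θ θ' :=
  (hM.density_measurable θ).div (hM.density_measurable θ')

theorem importanceWeight_self (hM : M.WellPosed) (x : X) (θ : EuclideanSpace ℝ (Fin n)) :
    M.importanceWeight x θ θ = 1 :=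
  div_self (hM.density_pos _ _).ne'

theorem importanceWeight_mul (hM : M.WellPosed) (x : X) (a b c : EuclideanSpace ℝ (Fin n)) :
    M.importanceWeight x a b * M.importanceWeight x b c = M.importanceWeight x a c :=
  div_mul_div_cancel₀ (hM.density_pos _ _).ne'

/-- All policies are mutually absolutely continuous, so that one of them, a probability measure, can
serve as the reference measure for the others, in place of `M.refMeasure`. -/
theorem policy_eq_withDensity (hM : M.WellPosed) (θ θ' : EuclideanSpace ℝ (Fin n)) :
    M.policy θ =
      (M.policy θ').withDensity fun x => ENNReal.ofReal (M.importanceWeight x θ θ') := by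
  unfold policy
  rw [← withDensity_mul _ (hM.density_measurable θ').ennreal_ofReal
    (measurable_importanceWeight hM θ θ').ennreal_ofReal]
  congr 1
  ext x
  rw [Pi.mul_apply, ← ENNReal.ofReal_mul (hM.density_pos _ _).le, importanceWeight,
    mul_div_cancel₀ _ (hM.density_pos _ _).ne']

theorem integral_policy_eq {E : Type*} [NormedAddCommGroup E] [NormedSpace ℝ E]
    (hM : M.WellPosed) (θ θ' : EuclideanSpace ℝ (Fin n)) (f : X → E) :
    ∫ x, f x ∂M.policy θ = ∫ x, M.importanceWeight x θ θ' • f x ∂M.policy θ' := by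
  rw [policy_eq_withDensity hM θ θ', integral_withDensity_eq_integral_toReal_smul
    (measurable_importanceWeight hM θ θ').ennreal_ofReal (by simp)]
  simp only [ENNReal.toReal_ofReal (importanceWeight_pos hM _ _ _).le]

theorem integrable_importanceWeight_smul {E : Type*} [NormedAddCommGroup E] [NormedSpace ℝ E]
    (hM : M.WellPosed) (θ θ' : EuclideanSpace ℝ (Fin n)) {f : X → E}
    (hf : Integrable f (M.policy θ)) :
    Integrable (fun x => M.importanceWeight x θ θ' • f x) (M.policy θ') := by
  rw [policy_eq_withDensity hM θ θ', integrable_withDensity_iff_integrable_smul'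
    (measurable_importanceWeight hM θ θ').ennreal_ofReal (by simp)] at hf
  simpa only [ENNReal.toReal_ofReal (importanceWeight_pos hM _ _ _).le] using hf

theorem integrable_importanceWeight (hM : M.WellPosed) (θ θ' : EuclideanSpace ℝ (Fin n)) :
    Integrable (fun x => M.importanceWeight x θ θ') (M.policy θ') := by
  have := hM.policy_prob θ
  simpa using integrable_importanceWeight_smul hM θ θ' (integrable_const (1 : ℝ))

theorem integral_importanceWeight (hM : M.WellPosed) (θ θ' : EuclideanSpace ℝ (Fin n)) :
    ∫ x, M.importanceWeight x θ θ' ∂M.policy θ' = 1 := by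
  have := hM.policy_prob θ
  simpa using (integral_policy_eq hM θ θ' fun _ => (1 : ℝ)).symm

theorem importanceWeight_eq_exp (hM : M.WellPosed) (x : X) (θ θ' : EuclideanSpace ℝ (Fin n)) :
    M.importanceWeight x θ θ' =
      Real.exp (Real.log (M.density θ x) - Real.log (M.density θ' x)) := by
  rw [Real.exp_sub, Real.exp_log (hM.density_pos _ _), Real.exp_log (hM.density_pos _ _),
    importanceWeight]

theorem abs_log_density_sub_le (hS : M.BoundedScore Cg Ch) (x : X)
    (θ θ' : EuclideanSpace ℝ (Fin n)) :
    |Real.log (M.density θ x) - Real.log (M.density θ' x)| ≤ Cg * ‖θ - θ'‖ :=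
  abs_sub_le_of_norm_gradient_le (hS.differentiable x) (fun a => hS.score_le a x) θ θ'

theorem importanceWeight_le_exp (hM : M.WellPosed) (hS : M.BoundedScore Cg Ch) (x : X)
    (θ θ' : EuclideanSpace ℝ (Fin n)) :
    M.importanceWeight x θ θ' ≤ Real.exp (Cg * ‖θ - θ'‖) := by
  rw [importanceWeight_eq_exp hM]
  exact Real.exp_le_exp.2 ((le_abs_self _).trans (abs_log_density_sub_le hS x θ θ'))

theorem abs_importanceWeight_sub_one_le (hM : M.WellPosed) (hS : M.BoundedScore Cg Ch) (x : X)
    (θ θ' : EuclideanSpace ℝ (Fin n)) :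
    |M.importanceWeight x θ θ' - 1| ≤ Cg * ‖θ - θ'‖ * Real.exp (Cg * ‖θ - θ'‖) := by
  rw [importanceWeight_eq_exp hM]
  exact abs_exp_sub_one_le_mul_exp (abs_log_density_sub_le hS x θ θ')

/-- Importance weights depend on the parameter in a Lipschitz way, in the `Lᵖ` norm: the Lipschitz
constant is the bound on the score times a bound on the `Lᵖ` norms of the weights. -/
theorem eLpNorm_importanceWeight_sub_one_le (hM : M.WellPosed) (hS : M.BoundedScore Cg Ch)
    (hCg : 0 < Cg) {p : ℝ≥0∞} (hp : 1 ≤ p) {K : ℝ} (θ θ' : EuclideanSpace ℝ (Fin n))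
    (hle : ∀ ϑ, eLpNorm (fun x => M.importanceWeight x ϑ θ') p (M.policy θ') ≤ ENNReal.ofReal K) :
    eLpNorm (fun x => M.importanceWeight x θ θ' - 1) p (M.policy θ') ≤
      ENNReal.ofReal (K * Cg * ‖θ - θ'‖) := by
  have hmeas := fun a => (measurable_importanceWeight hM a θ').aestronglyMeasurable
    (μ := M.policy θ')
  have := le_ofReal_mul_norm_sub_of_triangle (K := K * Cg) (c := Cg)
    (D := fun a b => eLpNorm
      ((fun x => M.importanceWeight x a θ') - fun x => M.importanceWeight x b θ') p (M.policy θ'))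
    ?_ ?_ θ θ'
  · simp only [importanceWeight_self hM] at this
    exact this
  · intro a b c
    refine (eLpNorm_congr_ae ?_).trans_le
      (eLpNorm_add_le ((hmeas a).sub (hmeas b)) ((hmeas b).sub (hmeas c)) hp)
    exact Filter.Eventually.of_forall fun x => by simp
  · intro a b
    have h1 := eLpNorm_le_mul_eLpNorm_of_ae_le_mul (μ := M.policy θ') (p := p)
      (f := (fun x => M.importanceWeight x a θ') - fun x => M.importanceWeight x b θ')
      (g := fun x => M.importanceWeight x b θ')
      (c := Cg * ‖a - b‖ * Real.exp (Cg * ‖a - b‖)) ?_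
    · refine h1.trans ((mul_le_mul_right (hle b) _).trans ?_)
      rw [← ENNReal.ofReal_mul (by positivity)]
      apply ENNReal.ofReal_le_ofReal
      apply le_of_eq
      ring
    · refine Filter.Eventually.of_forall fun x => ?_
      have h2 : ((fun x => M.importanceWeight x a θ') - fun x => M.importanceWeight x b θ') x =
          (M.importanceWeight x a b - 1) * M.importanceWeight x b θ' := by
        rw [sub_mul, importanceWeight_mul hM, one_mul, Pi.sub_apply]
      rw [h2, norm_mul]
      exact mul_le_mul_of_nonneg_right (abs_importanceWeight_sub_one_le hM hS x a b) (norm_nonneg _)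

theorem integral_abs_importanceWeight_sub_one_le (hM : M.WellPosed) (hS : M.BoundedScore Cg Ch)
    (hCg : 0 < Cg) (θ θ' : EuclideanSpace ℝ (Fin n)) :
    ∫ x, |M.importanceWeight x θ θ' - 1| ∂M.policy θ' ≤ Cg * ‖θ - θ'‖ := by
  have := hM.policy_prob θ'
  have h := eLpNorm_importanceWeight_sub_one_le hM hS hCg le_rfl (K := 1) θ θ' fun ϑ => by
    rw [eLpNorm_one_eq_lintegral_enorm,
      ← ofReal_integral_norm_eq_lintegral_enorm (integrable_importanceWeight hM ϑ θ')]
    simp only [Real.norm_of_nonneg (importanceWeight_pos hM _ _ _).le]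
    rw [integral_importanceWeight hM]
  have hint : Integrable (fun x => M.importanceWeight x θ θ' - 1) (M.policy θ') :=
    (integrable_importanceWeight hM θ θ').sub (integrable_const 1)
  rw [eLpNorm_one_eq_lintegral_enorm, ← ofReal_integral_norm_eq_lintegral_enorm hint,
    ENNReal.ofReal_le_ofReal_iff (by positivity), one_mul] at h
  exact h

theorem memLp_importanceWeight_sub_one (hM : M.WellPosed) (hW : M.BoundedImportanceWeight Cw)
    (θ θ' : EuclideanSpace ℝ (Fin n)) :
    MemLp (fun x => M.importanceWeight x θ θ' - 1) 2 (M.policy θ') := by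
  have hm := (measurable_importanceWeight hM θ θ').sub_const 1
  rw [memLp_two_iff_integrable_sq hm.aestronglyMeasurable]
  refine ⟨(hm.pow_const 2).aestronglyMeasurable, ?_⟩
  rw [hasFiniteIntegral_iff_ofReal (Filter.Eventually.of_forall fun x => sq_nonneg _)]
  exact (hW θ θ').trans_lt ENNReal.ofReal_lt_top

theorem memLp_importanceWeight (hM : M.WellPosed) (hW : M.BoundedImportanceWeight Cw)
    (θ θ' : EuclideanSpace ℝ (Fin n)) :
    MemLp (fun x => M.importanceWeight x θ θ') 2 (M.policy θ') := by
  have := hM.policy_prob θ'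
  have h := (memLp_importanceWeight_sub_one hM hW θ θ').add (memLp_const (1 : ℝ))
  refine h.ae_eq (Filter.Eventually.of_forall fun x => ?_)
  simp

/-- The second moment of a weight is its variance plus the square of its mean, which is `1`. -/
theorem integral_sq_importanceWeight_le (hM : M.WellPosed) (hW : M.BoundedImportanceWeight Cw)
    (θ θ' : EuclideanSpace ℝ (Fin n)) :
    ∫ x, M.importanceWeight x θ θ' ^ 2 ∂M.policy θ' ≤ Cw ^ 2 + 1 := by
  have := hM.policy_prob θ'
  have h1 := (memLp_importanceWeight_sub_one hM hW θ θ').integrable_sq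
  have h2 := integrable_importanceWeight hM θ θ'
  have h3 : ∫ x, (M.importanceWeight x θ θ' - 1) ^ 2 ∂M.policy θ' ≤ Cw ^ 2 := by
    have h := hW θ θ'
    rwa [← ofReal_integral_eq_lintegral_ofReal h1
      (Filter.Eventually.of_forall fun x => sq_nonneg _),
      ENNReal.ofReal_le_ofReal_iff (sq_nonneg _)] at h
  have h4 : ∫ x, M.importanceWeight x θ θ' ^ 2 ∂M.policy θ' =
      ∫ x, (M.importanceWeight x θ θ' - 1) ^ 2 + (2 * M.importanceWeight x θ θ' - 1)
        ∂M.policy θ' := by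
    congr 1; ext x; ring
  have h5 : Integrable (fun x => 2 * M.importanceWeight x θ θ') (M.policy θ') := h2.const_mul 2
  have h6 : Integrable (fun x => 2 * M.importanceWeight x θ θ' - 1) (M.policy θ') :=
    h5.sub (integrable_const 1)
  rw [h4, integral_add h1 h6, integral_sub h5 (integrable_const 1),
    integral_const_mul, integral_importanceWeight hM]
  simp only [integral_const, probReal_univ, smul_eq_mul]
  linarith

theorem eLpNorm_two_eq_ofReal_sqrt {Ω : Type*} [MeasurableSpace Ω] {μ : Measure Ω} {f : Ω → ℝ}
    (hf : MemLp f 2 μ) : eLpNorm f 2 μ = ENNReal.ofReal (√(∫ x, f x ^ 2 ∂μ)) := by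
  rw [hf.eLpNorm_eq_integral_rpow_norm two_ne_zero ENNReal.ofNat_ne_top]
  simp [Real.sqrt_eq_rpow]

/-- The second moment of `π_θ / π_θ' - 1` is of the order of `‖θ - θ'‖²`. -/
theorem integral_sq_importanceWeight_sub_one_le (hM : M.WellPosed) (hS : M.BoundedScore Cg Ch)
    (hW : M.BoundedImportanceWeight Cw) (hCg : 0 < Cg) (θ θ' : EuclideanSpace ℝ (Fin n)) :
    ∫ x, (M.importanceWeight x θ θ' - 1) ^ 2 ∂M.policy θ' ≤
      Cg ^ 2 * (Cw ^ 2 + 1) * ‖θ - θ'‖ ^ 2 := by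
  have h := eLpNorm_importanceWeight_sub_one_le hM hS hCg one_le_two
    (K := √(Cw ^ 2 + 1)) θ θ' fun ϑ => by
      rw [eLpNorm_two_eq_ofReal_sqrt (memLp_importanceWeight hM hW ϑ θ')]
      exact ENNReal.ofReal_le_ofReal
        (Real.sqrt_le_sqrt (integral_sq_importanceWeight_le hM hW ϑ θ'))
  rw [eLpNorm_two_eq_ofReal_sqrt (memLp_importanceWeight_sub_one hM hW θ θ'),
    ENNReal.ofReal_le_ofReal_iff (by positivity)] at h
  have h2 := Real.sqrt_le_iff.1 h
  refine h2.2.trans_eq ?_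
  rw [mul_pow, mul_pow, Real.sq_sqrt (by positivity)]
  ring

end RewardProblem

/-! ### The policy gradient and its smoothness -/

namespace RewardProblem

variable {n : ℕ} {X : Type*} [MeasurableSpace X] {M : RewardProblem n X}
  {U Cg Ch Dg Dh Cw : ℝ}

theorem differentiable_rewardGrad (hR : M.BoundedReward U Dg Dh) (x : X) :
    Differentiable ℝ (M.rewardGrad x) := by
  have h : ContDiff ℝ 1 (fderiv ℝ fun θ => M.reward θ x) :=
    (hR.contDiff x).fderiv_right (by norm_num)
  exact (InnerProductSpace.toDual ℝ (EuclideanSpace ℝ (Fin n))).symm.toContinuousLinearEquiv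
    |>.differentiable.comp (h.differentiable (by norm_num))

theorem differentiable_reward (hR : M.BoundedReward U Dg Dh) (x : X) :
    Differentiable ℝ fun θ => M.reward θ x :=
  (hR.contDiff x).differentiable (by norm_num)

theorem measurable_score (hM : M.WellPosed) (hS : M.BoundedScore Cg Ch)
    (θ : EuclideanSpace ℝ (Fin n)) : Measurable fun x => M.score x θ :=
  measurable_gradient_of_measurable (f := fun ϑ x => Real.log (M.density ϑ x))
    (fun ϑ => (hM.density_measurable ϑ).log) hS.differentiable θ

theorem measurable_rewardGrad (hM : M.WellPosed) (hR : M.BoundedReward U Dg Dh)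
    (θ : EuclideanSpace ℝ (Fin n)) : Measurable fun x => M.rewardGrad x θ :=
  measurable_gradient_of_measurable hM.reward_measurable (differentiable_reward hR) θ

theorem measurable_sampleGrad (hM : M.WellPosed) (hR : M.BoundedReward U Dg Dh)
    (hS : M.BoundedScore Cg Ch) (θ : EuclideanSpace ℝ (Fin n)) :
    Measurable fun x => M.sampleGrad x θ :=
  ((hM.reward_measurable θ).smul (measurable_score hM hS θ)).add (measurable_rewardGrad hM hR θ)

theorem norm_sampleGrad_le (hR : M.BoundedReward U Dg Dh) (hS : M.BoundedScore Cg Ch) (x : X)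
    (θ : EuclideanSpace ℝ (Fin n)) : ‖M.sampleGrad x θ‖ ≤ U * Cg + Dg := by
  have hU : 0 ≤ U := (abs_nonneg _).trans (hR.abs_le θ x)
  refine (norm_add_le _ _).trans (add_le_add ?_ (hR.grad_le θ x))
  rw [norm_smul]
  exact mul_le_mul (hR.abs_le θ x) (hS.score_le θ x) (norm_nonneg _) hU

theorem norm_sampleGrad_sub_le (hR : M.BoundedReward U Dg Dh) (hS : M.BoundedScore Cg Ch) (x : X)
    (θ θ' : EuclideanSpace ℝ (Fin n)) :
    ‖M.sampleGrad x θ - M.sampleGrad x θ'‖ ≤ (U * Ch + Cg * Dg + Dh) * ‖θ - θ'‖ := by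
  have hU : 0 ≤ U := (abs_nonneg _).trans (hR.abs_le θ x)
  have hDg : 0 ≤ Dg := (norm_nonneg _).trans (hR.grad_le θ x)
  have h1 := norm_sub_le_of_norm_fderiv_le (hS.score_differentiable x)
    (fun a => hS.hessian_le a x) θ θ'
  have h2 := norm_sub_le_of_norm_fderiv_le (differentiable_rewardGrad hR x)
    (fun a => hR.hessian_le a x) θ θ'
  have h3 := abs_sub_le_of_norm_gradient_le (differentiable_reward hR x)
    (fun a => hR.grad_le a x) θ θ'
  have h4 : M.sampleGrad x θ - M.sampleGrad x θ' =
      M.reward θ x • (M.score x θ - M.score x θ') +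
        (M.reward θ x - M.reward θ' x) • M.score x θ' +
        (M.rewardGrad x θ - M.rewardGrad x θ') := by
    simp only [sampleGrad, smul_sub, sub_smul]
    abel
  rw [h4]
  calc _ ≤ U * (Ch * ‖θ - θ'‖) + Dg * ‖θ - θ'‖ * Cg + Dh * ‖θ - θ'‖ := by
        refine norm_add₃_le.trans (add_le_add (add_le_add ?_ ?_) h2)
        · rw [norm_smul]
          exact mul_le_mul (hR.abs_le θ x) h1 (norm_nonneg _) hU
        · rw [norm_smul]
          exact mul_le_mul h3 (hS.score_le θ' x) (norm_nonneg _) (by positivity)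
    _ = _ := by ring

theorem integrable_sampleGrad (hM : M.WellPosed) (hR : M.BoundedReward U Dg Dh)
    (hS : M.BoundedScore Cg Ch) (θ θ' : EuclideanSpace ℝ (Fin n)) :
    Integrable (fun x => M.sampleGrad x θ) (M.policy θ') := by
  have := hM.policy_prob θ'
  exact Integrable.of_bound (measurable_sampleGrad hM hR hS θ).aestronglyMeasurable (U * Cg + Dg)
    (Filter.Eventually.of_forall fun x => norm_sampleGrad_le hR hS x θ)

theorem integrable_weightedGrad (hM : M.WellPosed) (hR : M.BoundedReward U Dg Dh)
    (hS : M.BoundedScore Cg Ch) (θ θ' : EuclideanSpace ℝ (Fin n)) :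
    Integrable (fun x => M.weightedGrad x θ θ') (M.policy θ') :=
  integrable_importanceWeight_smul hM θ θ' (integrable_sampleGrad hM hR hS θ θ)

theorem hasFDerivAt_importanceWeight_mul_reward (hM : M.WellPosed) (hR : M.BoundedReward U Dg Dh)
    (hS : M.BoundedScore Cg Ch) (x : X) (θ θ' : EuclideanSpace ℝ (Fin n)) :
    HasFDerivAt (fun ϑ => M.importanceWeight x ϑ θ' * M.reward ϑ x)
      (InnerProductSpace.toDual ℝ _ (M.weightedGrad x θ θ')) θ := by
  have h1 : HasFDerivAt (fun ϑ => M.importanceWeight x ϑ θ')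
      (M.importanceWeight x θ θ' • fderiv ℝ (fun ϑ => Real.log (M.density ϑ x)) θ) θ := by
    have := ((hS.differentiable x θ).hasFDerivAt.sub_const (Real.log (M.density θ' x))).exp
    simpa only [← importanceWeight_eq_exp hM] using this
  refine (h1.mul (differentiable_reward hR x θ).hasFDerivAt).congr_fderiv ?_
  ext v
  simp only [weightedGrad, sampleGrad, score, rewardGrad, InnerProductSpace.toDual_apply_apply,
    inner_smul_left, inner_add_left, inner_gradient_left, add_apply,
    smul_apply, smul_eq_mul, conj_trivial]
  ring

/-- The policy gradient theorem: `∇J(θ)` is the expectation of `g(x, θ)` for `x ∼ π_θ`. -/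
theorem hasGradientAt_expectedReward (hM : M.WellPosed) (hR : M.BoundedReward U Dg Dh)
    (hS : M.BoundedScore Cg Ch) (θ : EuclideanSpace ℝ (Fin n)) :
    HasGradientAt M.expectedReward (∫ x, M.sampleGrad x θ ∂M.policy θ) θ := by
  have hprob := hM.policy_prob θ
  obtain ⟨x₀⟩ := (M.policy θ).nonempty_of_neZero
  have hU : 0 ≤ U := (abs_nonneg _).trans (hR.abs_le θ x₀)
  have hDg : 0 ≤ Dg := (norm_nonneg _).trans (hR.grad_le θ x₀)
  have hCg : 0 ≤ Cg := (norm_nonneg _).trans (hS.score_le θ x₀)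
  -- write `J` near `θ` as an integral against the fixed measure `π_θ`
  have hJ : M.expectedReward =
      fun ϑ => ∫ x, M.importanceWeight x ϑ θ * M.reward ϑ x ∂M.policy θ := by
    ext ϑ
    exact integral_policy_eq hM ϑ θ _
  have hmeas : ∀ ϑ, Measurable fun x => M.weightedGrad x ϑ θ := fun ϑ =>
    (measurable_importanceWeight hM ϑ θ).smul (measurable_sampleGrad hM hR hS ϑ)
  have hself : (fun x => M.weightedGrad x θ θ) = fun x => M.sampleGrad x θ := by
    ext1 x
    rw [weightedGrad, importanceWeight_self hM, one_smul]
  have key := hasFDerivAt_integral_of_dominated_of_fderiv_le (𝕜 := ℝ) (μ := M.policy θ)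
    (F := fun ϑ x => M.importanceWeight x ϑ θ * M.reward ϑ x)
    (F' := fun ϑ x => InnerProductSpace.toDual ℝ _ (M.weightedGrad x ϑ θ))
    (bound := fun _ => Real.exp Cg * (U * Cg + Dg)) (x₀ := θ)
    (Metric.ball_mem_nhds θ one_pos) ?_ ?_ ?_ ?_ (integrable_const _)
    (Filter.Eventually.of_forall fun x ϑ _ =>
      hasFDerivAt_importanceWeight_mul_reward hM hR hS x ϑ θ)
  · rw [hJ, hasGradientAt_iff_hasFDerivAt]
    refine key.congr_fderiv ?_
    have hint := integrable_sampleGrad hM hR hS θ θ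
    ext v
    rw [ContinuousLinearMap.integral_apply]
    · simp only [InnerProductSpace.toDual_apply_apply, weightedGrad, importanceWeight_self hM,
        one_smul]
      rw [real_inner_comm, ← integral_inner hint]
      simp only [real_inner_comm]
    · refine Integrable.of_bound (C := U * Cg + Dg) ?_ ?_
      · exact (((InnerProductSpace.toDual ℝ _).continuous.measurable.comp
          (hmeas θ))).aestronglyMeasurable
      · refine Filter.Eventually.of_forall fun x => ?_
        rw [LinearIsometryEquiv.norm_map, congrFun hself x]
        exact norm_sampleGrad_le hR hS x θ
  · exact Filter.Eventually.of_forall fun ϑ => ((measurable_importanceWeight hM ϑ θ).mul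
      (hM.reward_measurable ϑ)).aestronglyMeasurable
  · refine Integrable.of_bound (((measurable_importanceWeight hM θ θ).mul
      (hM.reward_measurable θ)).aestronglyMeasurable) U ?_
    refine Filter.Eventually.of_forall fun x => ?_
    rw [importanceWeight_self hM, one_mul]
    exact hR.abs_le θ x
  · exact (((InnerProductSpace.toDual ℝ _).continuous.measurable.comp
      (hmeas θ))).aestronglyMeasurable
  · refine Filter.Eventually.of_forall fun x ϑ hϑ => ?_
    rw [LinearIsometryEquiv.norm_map, weightedGrad, norm_smul,
      Real.norm_of_nonneg (importanceWeight_pos hM _ _ _).le]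
    refine mul_le_mul ((importanceWeight_le_exp hM hS x ϑ θ).trans (Real.exp_le_exp.2 ?_))
      (norm_sampleGrad_le hR hS x ϑ) (norm_nonneg _) (Real.exp_pos _).le
    rw [Metric.mem_ball, dist_eq_norm] at hϑ
    nlinarith

theorem gradient_expectedReward (hM : M.WellPosed) (hR : M.BoundedReward U Dg Dh)
    (hS : M.BoundedScore Cg Ch) (θ : EuclideanSpace ℝ (Fin n)) :
    gradient M.expectedReward θ = ∫ x, M.sampleGrad x θ ∂M.policy θ :=
  (hasGradientAt_expectedReward hM hR hS θ).gradient

/-- The importance-weighted gradient is an unbiased estimator of `∇J(θ)` from samples of `π_θ'`. -/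
theorem integral_weightedGrad (hM : M.WellPosed) (hR : M.BoundedReward U Dg Dh)
    (hS : M.BoundedScore Cg Ch) (θ θ' : EuclideanSpace ℝ (Fin n)) :
    ∫ x, M.weightedGrad x θ θ' ∂M.policy θ' = gradient M.expectedReward θ := by
  rw [gradient_expectedReward hM hR hS, integral_policy_eq hM θ θ']
  rfl

/-- The increment of the recursive estimator splits into a change of the integrand and a change of
the measure. -/
theorem weightedGrad_sub_sampleGrad (x : X) (θ θ' : EuclideanSpace ℝ (Fin n)) :
    M.weightedGrad x θ θ' - M.sampleGrad x θ' =
      (M.sampleGrad x θ - M.sampleGrad x θ') +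
        (M.importanceWeight x θ θ' - 1) • M.sampleGrad x θ := by
  rw [weightedGrad, sub_smul, one_smul]
  abel

theorem norm_weightedGrad_sub_sampleGrad_le (hR : M.BoundedReward U Dg Dh)
    (hS : M.BoundedScore Cg Ch) (x : X) (θ θ' : EuclideanSpace ℝ (Fin n)) :
    ‖M.weightedGrad x θ θ' - M.sampleGrad x θ'‖ ≤ (U * Ch + Cg * Dg + Dh) * ‖θ - θ'‖ +
      |M.importanceWeight x θ θ' - 1| * (U * Cg + Dg) := by
  rw [weightedGrad_sub_sampleGrad]
  refine (norm_add_le _ _).trans (add_le_add (norm_sampleGrad_sub_le hR hS x θ θ') ?_)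
  rw [norm_smul, Real.norm_eq_abs]
  exact mul_le_mul_of_nonneg_left (norm_sampleGrad_le hR hS x θ) (abs_nonneg _)

/-- `∇J` is Lipschitz with constant `L`. -/
theorem norm_gradient_expectedReward_sub_le (hM : M.WellPosed) (hR : M.BoundedReward U Dg Dh)
    (hS : M.BoundedScore Cg Ch) (hU : 0 < U) (hCg : 0 < Cg) (hDg : 0 < Dg)
    (θ θ' : EuclideanSpace ℝ (Fin n)) :
    ‖gradient M.expectedReward θ - gradient M.expectedReward θ'‖ ≤
      constL U Cg Ch Dg Dh * ‖θ - θ'‖ := by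
  have := hM.policy_prob θ'
  have hw : Integrable (fun x => |M.importanceWeight x θ θ' - 1| * (U * Cg + Dg)) (M.policy θ') :=
    (((integrable_importanceWeight hM θ θ').sub (integrable_const 1)).abs).mul_const _
  rw [← integral_weightedGrad hM hR hS θ θ', gradient_expectedReward hM hR hS θ',
    ← integral_sub (integrable_weightedGrad hM hR hS θ θ') (integrable_sampleGrad hM hR hS θ' θ')]
  calc _ ≤ ∫ x, ((U * Ch + Cg * Dg + Dh) * ‖θ - θ'‖ +
        |M.importanceWeight x θ θ' - 1| * (U * Cg + Dg)) ∂M.policy θ' :=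
        norm_integral_le_of_norm_le ((integrable_const _).add hw)
          (Filter.Eventually.of_forall fun x =>
            norm_weightedGrad_sub_sampleGrad_le hR hS x θ θ')
    _ = (U * Ch + Cg * Dg + Dh) * ‖θ - θ'‖ +
        (∫ x, |M.importanceWeight x θ θ' - 1| ∂M.policy θ') * (U * Cg + Dg) := by
        rw [integral_add (integrable_const _) hw, integral_mul_const (U * Cg + Dg)]
        simp
    _ ≤ (U * Ch + Cg * Dg + Dh) * ‖θ - θ'‖ + (Cg * ‖θ - θ'‖) * (U * Cg + Dg) := by
        gcongr
        exact integral_abs_importanceWeight_sub_one_le hM hS hCg θ θ'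
    _ = _ := by
        rw [constL]
        ring

theorem memLp_weightedGrad_sub_sampleGrad (hM : M.WellPosed) (hR : M.BoundedReward U Dg Dh)
    (hS : M.BoundedScore Cg Ch) (hW : M.BoundedImportanceWeight Cw)
    (θ θ' : EuclideanSpace ℝ (Fin n)) :
    MemLp (fun x => M.weightedGrad x θ θ' - M.sampleGrad x θ') 2 (M.policy θ') := by
  have := hM.policy_prob θ'
  have h0 : MemLp (fun x => |M.importanceWeight x θ θ' - 1|) 2 (M.policy θ') :=
    (memLp_importanceWeight_sub_one hM hW θ θ').norm
  have h1 : MemLp (fun x => |M.importanceWeight x θ θ' - 1| * (U * Cg + Dg)) 2 (M.policy θ') :=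
    h0.mul_const _
  have hc : MemLp (fun _ : X => (U * Ch + Cg * Dg + Dh) * ‖θ - θ'‖) 2 (M.policy θ') :=
    memLp_const _
  have hm : Measurable fun x => M.weightedGrad x θ θ' - M.sampleGrad x θ' :=
    ((measurable_importanceWeight hM θ θ').smul (measurable_sampleGrad hM hR hS θ)).sub
      (measurable_sampleGrad hM hR hS θ')
  exact (hc.add h1).of_le hm.aestronglyMeasurable (Filter.Eventually.of_forall fun x =>
    (norm_weightedGrad_sub_sampleGrad_le hR hS x θ θ').trans (le_abs_self _))

/-- The second moment of the increment of the recursive estimator is at most `C ‖θ - θ'‖²`. -/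
theorem integral_sq_norm_weightedGrad_sub_sampleGrad_le (hM : M.WellPosed)
    (hR : M.BoundedReward U Dg Dh) (hS : M.BoundedScore Cg Ch) (hW : M.BoundedImportanceWeight Cw)
    (hU : 0 < U) (hCg : 0 < Cg) (hCh : 0 < Ch) (hDg : 0 < Dg) (θ θ' : EuclideanSpace ℝ (Fin n)) :
    ∫ x, ‖M.weightedGrad x θ θ' - M.sampleGrad x θ'‖ ^ 2 ∂M.policy θ' ≤
      constC U Cg Ch Dg Dh Cw * ‖θ - θ'‖ ^ 2 := by
  have := hM.policy_prob θ'
  have hw : Integrable (fun x => (M.importanceWeight x θ θ' - 1) ^ 2 *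
      (2 * (U * Cg + Dg) ^ 2)) (M.policy θ') :=
    (memLp_importanceWeight_sub_one hM hW θ θ').integrable_sq.mul_const _
  calc _ ≤ ∫ x, (2 * ((U * Ch + Cg * Dg + Dh) * ‖θ - θ'‖) ^ 2 +
        (M.importanceWeight x θ θ' - 1) ^ 2 * (2 * (U * Cg + Dg) ^ 2)) ∂M.policy θ' := by
        refine integral_mono (memLp_weightedGrad_sub_sampleGrad hM hR hS hW θ θ').norm.integrable_sq
          ((integrable_const _).add hw) fun x => ?_
        have h1 := norm_weightedGrad_sub_sampleGrad_le hR hS x θ θ'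
        have h2 := pow_le_pow_left₀ (norm_nonneg _) h1 2
        refine h2.trans (add_sq_le.trans_eq ?_)
        rw [mul_pow |_|, sq_abs]
        ring
    _ = 2 * ((U * Ch + Cg * Dg + Dh) * ‖θ - θ'‖) ^ 2 +
        (∫ x, (M.importanceWeight x θ θ' - 1) ^ 2 ∂M.policy θ') * (2 * (U * Cg + Dg) ^ 2) := by
        rw [integral_add (integrable_const _) hw, integral_mul_const (2 * (U * Cg + Dg) ^ 2)]
        simp
    _ ≤ 2 * ((U * Ch + Cg * Dg + Dh) * ‖θ - θ'‖) ^ 2 +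
        (Cg ^ 2 * (Cw ^ 2 + 1) * ‖θ - θ'‖ ^ 2) * (2 * (U * Cg + Dg) ^ 2) := by
        gcongr
        exact integral_sq_importanceWeight_sub_one_le hM hS hW hCg θ θ'
    _ = (2 * (U * Ch + Cg * Dg + Dh) ^ 2 +
        2 * (U * Cg + Dg) ^ 2 * Cg ^ 2 * (Cw ^ 2 + 1)) * ‖θ - θ'‖ ^ 2 := by ring
    _ ≤ _ := by
        refine mul_le_mul_of_nonneg_right (add_le_add ?_ ?_) (sq_nonneg _)
        · nlinarith [sq_nonneg (U * Ch - Cg * Dg), sq_nonneg (U * Ch - Dh),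
            sq_nonneg (Cg * Dg - Dh)]
        · refine mul_le_mul_of_nonneg_right ?_ (by positivity)
          refine mul_le_mul ?_ ?_ (sq_nonneg _) (by positivity)
          · nlinarith [sq_nonneg (U * Cg - Dg)]
          · nlinarith [sq_nonneg Cg]

end RewardProblem

/-! ### Variance of mini-batch estimators -/

section BatchVariance

variable {Ω : Type*} [MeasurableSpace Ω] {ν : Measure Ω} [IsProbabilityMeasure ν] {N : ℕ}

theorem memLp_average_add {Y : Ω → ℝ} (hY : MemLp Y 2 ν) (a : ℝ) :
    MemLp (fun x : Fin N → Ω => (N : ℝ)⁻¹ * ∑ j, Y (x j) + a) 2 (Measure.pi fun _ => ν) := by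
  have h : ∀ j : Fin N, MemLp (fun x : Fin N → Ω => Y (x j)) 2 (Measure.pi fun _ => ν) :=
    fun j => hY.comp_measurePreserving (measurePreserving_eval (fun _ : Fin N => ν) j)
  exact ((memLp_finsetSum Finset.univ fun j _ => h j).const_mul _).add (memLp_const a)

theorem integral_sq_average_sub_add_le {Y : Ω → ℝ} (hN : N ≠ 0) (hY : MemLp Y 2 ν) (e : ℝ) :
    ∫ x : Fin N → Ω, ((N : ℝ)⁻¹ * ∑ j, Y (x j) + (e - ∫ ω, Y ω ∂ν)) ^ 2
        ∂(Measure.pi fun _ => ν) ≤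
      e ^ 2 + (∫ ω, Y ω ^ 2 ∂ν) / N := by
  set m := ∫ ω, Y ω ∂ν with hm
  have hN' : (N : ℝ) ≠ 0 := Nat.cast_ne_zero.2 hN
  have hj : ∀ j : Fin N, ∫ x : Fin N → Ω, Y (x j) ∂(Measure.pi fun _ => ν) = m := fun j =>
    integral_comp_eval (μ := fun _ : Fin N => ν) hY.aestronglyMeasurable
  have hint : ∀ j : Fin N, Integrable (fun x : Fin N → Ω => Y (x j)) (Measure.pi fun _ => ν) :=
    fun j => (hY.comp_measurePreserving
      (measurePreserving_eval (fun _ : Fin N => ν) j)).integrable one_le_two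
  have hmean : ∫ x : Fin N → Ω, ((N : ℝ)⁻¹ * ∑ j, Y (x j) + (e - m)) ∂(Measure.pi fun _ => ν) =
      e := by
    rw [integral_add ((integrable_finsetSum _ fun j _ => hint j).const_mul _)
      (integrable_const _), integral_const_mul, integral_finsetSum _ fun j _ => hint j]
    simp only [hj]
    simp
    field_simp
    ring
  have hsum : (∑ j : Fin N, fun x : Fin N → Ω => Y (x j)) = fun x => ∑ j, Y (x j) := by
    ext x
    simp
  -- second moment = variance + square of the mean `e`
  have hvar := ProbabilityTheory.variance_eq_sub (memLp_average_add (N := N) hY (e - m))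
  have hsumvar := ProbabilityTheory.variance_sum_pi (μ := fun _ : Fin N => ν)
    (X := fun _ => Y) fun _ => hY
  rw [hsum] at hsumvar
  have hmeas : AEStronglyMeasurable (fun x : Fin N → Ω => (N : ℝ)⁻¹ * ∑ j, Y (x j))
      (Measure.pi fun _ => ν) := by
    simpa using (memLp_average_add (N := N) hY 0).aestronglyMeasurable
  rw [ProbabilityTheory.variance_add_const hmeas, ProbabilityTheory.variance_const_mul,
    hsumvar, hmean] at hvar
  have hle := ProbabilityTheory.variance_le_expectation_sq (μ := ν) hY.aestronglyMeasurable
  simp only [Pi.pow_apply, Finset.sum_const, Finset.card_univ, Fintype.card_fin,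
    nsmul_eq_mul] at hvar hle
  have h2 : ((N : ℝ)⁻¹) ^ 2 * (N * ProbabilityTheory.variance Y ν) =
      ProbabilityTheory.variance Y ν / N := by field_simp
  rw [h2] at hvar
  have h3 : ProbabilityTheory.variance Y ν / N ≤ (∫ ω, Y ω ^ 2 ∂ν) / N := by gcongr
  linarith

/-- The average of `N` independent copies of a square-integrable random vector `Y` deviates from the
mean of `Y` by at most `E‖Y‖² / N` in mean square. A fixed vector `e` added to this deviation adds
only `‖e‖²`, as the cross term vanishes; `e` will be the error of the previous estimator. -/
theorem lintegral_sq_norm_average_sub_add_le {n : ℕ} {Y : Ω → EuclideanSpace ℝ (Fin n)}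
    (hN : N ≠ 0) (hY : MemLp Y 2 ν) (e : EuclideanSpace ℝ (Fin n)) :
    ∫⁻ x : Fin N → Ω, ENNReal.ofReal (‖(N : ℝ)⁻¹ • ∑ j, Y (x j) - ∫ ω, Y ω ∂ν + e‖ ^ 2)
        ∂Measure.pi (fun _ => ν) ≤
      ENNReal.ofReal (‖e‖ ^ 2 + (∫ ω, ‖Y ω‖ ^ 2 ∂ν) / N) := by
  have hi : ∀ i, MemLp (fun ω => Y ω i) 2 ν := fun i =>
    (EuclideanSpace.proj (𝕜 := ℝ) i : EuclideanSpace ℝ (Fin n) →L[ℝ] ℝ).comp_memLp' hY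
  have hmean : ∀ i, (∫ ω, Y ω ∂ν) i = ∫ ω, Y ω i ∂ν := fun i =>
    ((EuclideanSpace.proj (𝕜 := ℝ) i : EuclideanSpace ℝ (Fin n) →L[ℝ] ℝ).integral_comp_comm
      (hY.integrable one_le_two)).symm
  have hnorm : ∀ x : Fin N → Ω, ‖(N : ℝ)⁻¹ • ∑ j, Y (x j) - ∫ ω, Y ω ∂ν + e‖ ^ 2 =
      ∑ i, ((N : ℝ)⁻¹ * ∑ j, Y (x j) i + (e i - ∫ ω, Y ω i ∂ν)) ^ 2 := by
    intro x
    rw [EuclideanSpace.real_norm_sq_eq]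
    refine Finset.sum_congr rfl fun i _ => ?_
    rw [← hmean i]
    simp
    ring
  have hint := fun i => (memLp_average_add (N := N) (hi i) (e i - ∫ ω, Y ω i ∂ν)).integrable_sq
  simp only [hnorm]
  rw [← ofReal_integral_eq_lintegral_ofReal (integrable_finsetSum _ fun i _ => hint i)
    (Filter.Eventually.of_forall fun x => Finset.sum_nonneg fun i _ => sq_nonneg _)]
  refine ENNReal.ofReal_le_ofReal ?_
  rw [integral_finsetSum _ fun i _ => hint i]
  refine (Finset.sum_le_sum fun i _ => integral_sq_average_sub_add_le hN (hi i) (e i)).trans_eq ?_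
  rw [Finset.sum_add_distrib, ← Finset.sum_div, ← EuclideanSpace.real_norm_sq_eq,
    ← integral_finsetSum _ fun i _ => (hi i).integrable_sq]
  simp only [EuclideanSpace.real_norm_sq_eq]

end BatchVariance

namespace RewardProblem

variable {n : ℕ} {X : Type*} [MeasurableSpace X] {M : RewardProblem n X}
  {U Cg Ch Dg Dh Cw : ℝ}

theorem lintegral_fullEstimator_error_le (hM : M.WellPosed) (hR : M.BoundedReward U Dg Dh)
    (hS : M.BoundedScore Cg Ch) {N : ℕ} (hN : N ≠ 0) (θ : EuclideanSpace ℝ (Fin n)) :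
    ∫⁻ x, ENNReal.ofReal (‖M.fullEstimator x θ - gradient M.expectedReward θ‖ ^ 2)
      ∂M.batchLaw N θ ≤ ENNReal.ofReal ((U * Cg + Dg) ^ 2 / N) := by
  have := hM.policy_prob θ
  have hY : MemLp (fun x => M.sampleGrad x θ) 2 (M.policy θ) :=
    MemLp.of_bound (measurable_sampleGrad hM hR hS θ).aestronglyMeasurable (U * Cg + Dg)
      (Filter.Eventually.of_forall fun x => norm_sampleGrad_le hR hS x θ)
  have hsq : ∫ x, ‖M.sampleGrad x θ‖ ^ 2 ∂M.policy θ ≤ (U * Cg + Dg) ^ 2 := by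
    calc ∫ x, ‖M.sampleGrad x θ‖ ^ 2 ∂M.policy θ ≤ ∫ _, (U * Cg + Dg) ^ 2 ∂M.policy θ :=
          integral_mono hY.norm.integrable_sq (integrable_const _) fun x =>
            pow_le_pow_left₀ (norm_nonneg _) (norm_sampleGrad_le hR hS x θ) 2
      _ = _ := by simp
  have h := lintegral_sq_norm_average_sub_add_le hN hY 0
  simp only [add_zero, norm_zero] at h
  rw [gradient_expectedReward hM hR hS θ]
  refine h.trans (ENNReal.ofReal_le_ofReal ?_)
  rw [zero_pow two_ne_zero, zero_add]
  gcongr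

theorem lintegral_recursiveEstimator_error_le (hM : M.WellPosed) (hR : M.BoundedReward U Dg Dh)
    (hS : M.BoundedScore Cg Ch) (hW : M.BoundedImportanceWeight Cw)
    (hU : 0 < U) (hCg : 0 < Cg) (hCh : 0 < Ch) (hDg : 0 < Dg) {N : ℕ} (hN : N ≠ 0)
    (θ θ' g : EuclideanSpace ℝ (Fin n)) :
    ∫⁻ x, ENNReal.ofReal (‖M.recursiveEstimator x θ θ' g - gradient M.expectedReward θ'‖ ^ 2)
      ∂M.batchLaw N θ' ≤ ENNReal.ofReal (‖g - gradient M.expectedReward θ‖ ^ 2 +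
        constC U Cg Ch Dg Dh Cw * ‖θ' - θ‖ ^ 2 / N) := by
  have := hM.policy_prob θ'
  have hY := (memLp_weightedGrad_sub_sampleGrad hM hR hS hW θ θ').neg
  have h := lintegral_sq_norm_average_sub_add_le hN hY (g - gradient M.expectedReward θ)
  have hmean : ∫ x, (-fun x => M.weightedGrad x θ θ' - M.sampleGrad x θ') x ∂M.policy θ' =
      gradient M.expectedReward θ' - gradient M.expectedReward θ := by
    simp only [Pi.neg_apply]
    rw [integral_neg, integral_sub (integrable_weightedGrad hM hR hS θ θ')
      (integrable_sampleGrad hM hR hS θ' θ'), integral_weightedGrad hM hR hS,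
      ← gradient_expectedReward hM hR hS θ', neg_sub]
  rw [hmean] at h
  refine (le_of_eq ?_).trans (h.trans (ENNReal.ofReal_le_ofReal ?_))
  · refine lintegral_congr fun x => ?_
    congr 3
    simp only [recursiveEstimator, Pi.neg_apply, neg_sub, Finset.sum_sub_distrib, smul_sub]
    abel
  · gcongr
    simp only [Pi.neg_apply, norm_neg]
    rw [norm_sub_rev θ' θ]
    exact integral_sq_norm_weightedGrad_sub_sampleGrad_le hM hR hS hW hU hCg hCh hDg θ θ'

end RewardProblem

/-! ### The proximal step -/

/-- The quadratic lower bound for a function with Lipschitz gradient. -/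
theorem add_inner_sub_le_of_lipschitz_gradient {F : Type*} [NormedAddCommGroup F]
    [InnerProductSpace ℝ F] [CompleteSpace F] {f : F → ℝ} {L : ℝ} (hf : Differentiable ℝ f)
    (hL : ∀ a b, ‖gradient f a - gradient f b‖ ≤ L * ‖a - b‖) (x y : F) :
    f x + inner ℝ (gradient f x) (y - x) - L / 2 * ‖y - x‖ ^ 2 ≤ f y := by
  set d := y - x with hd
  let φ : ℝ → ℝ := fun t => f (x + t • d) - t * inner ℝ (gradient f x) d + L / 2 * t ^ 2 * ‖d‖ ^ 2
  have hφ : ∀ t, HasDerivAt φ (inner ℝ (gradient f (x + t • d)) d - inner ℝ (gradient f x) d +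
      L * t * ‖d‖ ^ 2) t := by
    intro t
    have h1 : HasDerivAt (fun t : ℝ => x + t • d) d t := by
      simpa using ((hasDerivAt_id t).smul_const d).const_add x
    have h2 : HasDerivAt (fun t : ℝ => f (x + t • d)) (inner ℝ (gradient f (x + t • d)) d) t := by
      rw [inner_gradient_left]
      exact (hf (x + t • d)).hasFDerivAt.comp_hasDerivAt t h1
    have h3 : HasDerivAt (fun t : ℝ => t * inner ℝ (gradient f x) d)
        (inner ℝ (gradient f x) d) t := by
      simpa using (hasDerivAt_id t).mul_const (inner ℝ (gradient f x) d)
    have h4 : HasDerivAt (fun t : ℝ => L / 2 * t ^ 2 * ‖d‖ ^ 2) (L * t * ‖d‖ ^ 2) t := by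
      refine (((hasDerivAt_pow 2 t).const_mul (L / 2)).mul_const (‖d‖ ^ 2)).congr_deriv ?_
      simp only [Nat.cast_ofNat, Nat.reduceSub, pow_one]
      ring
    exact (h2.sub h3).add h4
  have hmono : MonotoneOn φ (Set.Ici 0) := by
    refine monotoneOn_of_deriv_nonneg (convex_Ici 0)
      (fun t _ => (hφ t).continuousAt.continuousWithinAt)
      (fun t _ => (hφ t).differentiableAt.differentiableWithinAt) fun t ht => ?_
    rw [interior_Ici] at ht
    have ht : 0 < t := ht
    rw [(hφ t).deriv, ← inner_sub_left]
    have h1 := abs_real_inner_le_norm (gradient f (x + t • d) - gradient f x) d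
    have h2 := hL (x + t • d) x
    rw [add_sub_cancel_left, norm_smul, Real.norm_of_nonneg ht.le] at h2
    have h3 := neg_le_of_abs_le (h1.trans (mul_le_mul_of_nonneg_right h2 (norm_nonneg d)))
    nlinarith
  have h := hmono (Set.mem_Ici.2 le_rfl) (Set.mem_Ici.2 zero_le_one) zero_le_one
  simp only [φ, zero_smul, add_zero, one_smul, hd, add_sub_cancel] at h
  rw [hd]
  linarith

namespace RewardProblem

variable {n : ℕ} {X : Type*} [MeasurableSpace X] {M : RewardProblem n X}
  {U Cg Ch Dg Dh Cw η : ℝ}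

theorem abs_expectedReward_le (hM : M.WellPosed) (hR : M.BoundedReward U Dg Dh)
    (θ : EuclideanSpace ℝ (Fin n)) : |M.expectedReward θ| ≤ U := by
  have := hM.policy_prob θ
  have h := norm_integral_le_of_norm_le_const (μ := M.policy θ) (f := M.reward θ) (C := U)
    (Filter.Eventually.of_forall fun x => hR.abs_le θ x)
  simpa [expectedReward] using h

theorem coe_toReal_regularizer (hM : M.WellPosed) {θ : EuclideanSpace ℝ (Fin n)}
    (h : M.regularizer θ ≠ ⊤) : (((M.regularizer θ).toReal : ℝ) : EReal) = M.regularizer θ :=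
  EReal.coe_toReal h (hM.regularizer_ne_bot θ)

/-- The regularizer is bounded below, since the reward is bounded and the optimal value finite. -/
theorem exists_forall_coe_le_regularizer (hM : M.WellPosed) (hR : M.BoundedReward U Dg Dh) :
    ∃ m : ℝ, ∀ θ, (m : EReal) ≤ M.regularizer θ := by
  refine ⟨-U - M.optimalValue.toReal, fun θ => ?_⟩
  by_cases h : M.regularizer θ = ⊤
  · rw [h]
    exact le_top
  · have h1 : M.objective θ ≤ M.optimalValue := le_iSup M.objective θ
    rw [objective, ← coe_toReal_regularizer hM h,
      ← EReal.coe_toReal hM.optimalValue_finite.2 hM.optimalValue_finite.1] at h1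
    rw [← coe_toReal_regularizer hM h]
    have h2 := neg_le_of_abs_le (abs_expectedReward_le hM hR θ)
    norm_cast at h1 ⊢
    linarith

/-- The proximal map is well defined: `G` is lower semicontinuous and bounded below, so the
quadratic term confines the minimization to a compact ball. -/
theorem exists_prox_minimizer (hM : M.WellPosed) (hR : M.BoundedReward U Dg Dh) (hη : 0 < η)
    (θ : EuclideanSpace ℝ (Fin n)) :
    ∃ y, ∀ z, M.regularizer y + ((‖y - θ‖ ^ 2 / (2 * η) : ℝ) : EReal) ≤
      M.regularizer z + ((‖z - θ‖ ^ 2 / (2 * η) : ℝ) : EReal) := by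
  obtain ⟨m, hm⟩ := exists_forall_coe_le_regularizer hM hR
  obtain ⟨x₀, hx₀⟩ := hM.regularizer_proper
  set h : EuclideanSpace ℝ (Fin n) → EReal :=
    fun y => M.regularizer y + ((‖y - θ‖ ^ 2 / (2 * η) : ℝ) : EReal) with hh
  have hlsc : LowerSemicontinuous h := by
    refine LowerSemicontinuous.add' hM.regularizer_closed
      (Continuous.lowerSemicontinuous (continuous_coe_real_ereal.comp (by fun_prop))) fun x => ?_
    exact EReal.continuousAt_add (Or.inr (EReal.coe_ne_bot _)) (Or.inr (EReal.coe_ne_top _))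
  set c : ℝ := (M.regularizer x₀).toReal + ‖x₀ - θ‖ ^ 2 / (2 * η) with hc
  have hcx : h x₀ = (c : EReal) := by
    rw [hh, hc, EReal.coe_add, coe_toReal_regularizer hM hx₀]
  -- outside the ball of radius `R` the objective exceeds its value `c` at `x₀`
  set R : ℝ := ‖x₀ - θ‖ + √(2 * η * (c - m)) with hRdef
  have hmem : x₀ ∈ Metric.closedBall θ R := by
    rw [Metric.mem_closedBall, dist_eq_norm, hRdef]
    linarith [Real.sqrt_nonneg (2 * η * (c - m))]
  obtain ⟨y, -, hy⟩ := LowerSemicontinuousOn.exists_isMinOn ⟨x₀, hmem⟩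
    (isCompact_closedBall θ R) (hlsc.lowerSemicontinuousOn _)
  refine ⟨y, fun z => ?_⟩
  by_cases hz : z ∈ Metric.closedBall θ R
  · exact hy hz
  · refine (hy hmem).trans ?_
    rw [hcx]
    rw [Metric.mem_closedBall, dist_eq_norm, not_le] at hz
    have h1 : 2 * η * (c - m) ≤ ‖z - θ‖ ^ 2 :=
      (Real.lt_sq_of_sqrt_lt (by linarith [norm_nonneg (x₀ - θ)])).le
    have h2 : c ≤ m + ‖z - θ‖ ^ 2 / (2 * η) := by
      have : c - m ≤ ‖z - θ‖ ^ 2 / (2 * η) := by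
        rw [le_div_iff₀ (by positivity)]
        linarith
      linarith
    calc (c : EReal) ≤ ((m + ‖z - θ‖ ^ 2 / (2 * η) : ℝ) : EReal) := by exact_mod_cast h2
      _ = (m : EReal) + ((‖z - θ‖ ^ 2 / (2 * η) : ℝ) : EReal) := EReal.coe_add _ _
      _ ≤ _ := by gcongr; exact hm z

theorem prox_isMin (hM : M.WellPosed) (hR : M.BoundedReward U Dg Dh) (hη : 0 < η)
    (θ z : EuclideanSpace ℝ (Fin n)) :
    M.regularizer (M.prox η θ) + ((‖M.prox η θ - θ‖ ^ 2 / (2 * η) : ℝ) : EReal) ≤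
      M.regularizer z + ((‖z - θ‖ ^ 2 / (2 * η) : ℝ) : EReal) :=
  Classical.epsilon_spec (exists_prox_minimizer hM hR hη θ) z

theorem regularizer_prox_ne_top (hM : M.WellPosed) (hR : M.BoundedReward U Dg Dh) (hη : 0 < η)
    (θ : EuclideanSpace ℝ (Fin n)) : M.regularizer (M.prox η θ) ≠ ⊤ := by
  obtain ⟨x₀, hx₀⟩ := hM.regularizer_proper
  intro h
  have := prox_isMin hM hR hη θ x₀
  rw [h, EReal.top_add_coe, top_le_iff, ← coe_toReal_regularizer hM hx₀, ← EReal.coe_add] at this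
  exact EReal.coe_ne_top _ this

theorem regularizer_convexComb_le (hM : M.WellPosed) {y z : EuclideanSpace ℝ (Fin n)}
    (hy : M.regularizer y ≠ ⊤) (hz : M.regularizer z ≠ ⊤) {t : ℝ} (ht0 : 0 ≤ t) (ht1 : t ≤ 1) :
    M.regularizer ((1 - t) • y + t • z) ≤
      (((1 - t) * (M.regularizer y).toReal + t * (M.regularizer z).toReal : ℝ) : EReal) :=
  hM.regularizer_convex (x := (y, (M.regularizer y).toReal)) (coe_toReal_regularizer hM hy).ge
    (y := (z, (M.regularizer z).toReal)) (coe_toReal_regularizer hM hz).ge (sub_nonneg.2 ht1) ht0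
    (sub_add_cancel _ _)

/-- The optimality condition of the proximal step: `(θ - y) / η` is a subgradient of the
regularizer at `y = Prox_{ηG}(θ)`. -/
theorem smul_sub_prox_mem_subdifferential (hM : M.WellPosed) (hR : M.BoundedReward U Dg Dh)
    (hη : 0 < η) (θ : EuclideanSpace ℝ (Fin n)) :
    η⁻¹ • (θ - M.prox η θ) ∈ M.subdifferential (M.prox η θ) := by
  intro z
  set y := M.prox η θ with hy
  have hyt : M.regularizer y ≠ ⊤ := regularizer_prox_ne_top hM hR hη θ
  by_cases hz : M.regularizer z = ⊤
  · rw [hz]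
    exact le_top
  rw [← coe_toReal_regularizer hM hyt, ← coe_toReal_regularizer hM hz]
  norm_cast
  set a := (M.regularizer y).toReal
  set b := (M.regularizer z).toReal
  -- compare `y` with the points `(1 - t) y + t z` of the segment from `y` to `z`, then let `t → 0`
  have key : ∀ t : ℝ, 0 < t → t ≤ 1 →
      a + inner ℝ (η⁻¹ • (θ - y)) (z - y) - b ≤ t * (‖z - y‖ ^ 2 / (2 * η)) := by
    intro t ht0 ht1
    have h1 := (prox_isMin hM hR hη θ ((1 - t) • y + t • z)).trans
      (add_le_add_left (regularizer_convexComb_le hM hyt hz ht0.le ht1) _)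
    rw [← hy, ← coe_toReal_regularizer hM hyt] at h1
    norm_cast at h1
    rw [EReal.toReal_coe] at h1
    have h2 : (1 - t) • y + t • z - θ = (y - θ) + t • (z - y) := by
      rw [sub_smul, one_smul, smul_sub]
      abel
    have h3 : ‖(y - θ) + t • (z - y)‖ ^ 2 =
        ‖y - θ‖ ^ 2 - 2 * t * inner ℝ (θ - y) (z - y) + t ^ 2 * ‖z - y‖ ^ 2 := by
      rw [norm_add_sq_real, inner_smul_right, norm_smul, Real.norm_of_nonneg ht0.le,
        ← neg_sub θ y, inner_neg_left, norm_neg]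
      ring
    rw [h2, h3] at h1
    rw [real_inner_smul_left]
    have h4 : t * (a + η⁻¹ * inner ℝ (θ - y) (z - y) - b) ≤
        t * (t * (‖z - y‖ ^ 2 / (2 * η))) := by
      have h5 : (‖y - θ‖ ^ 2 - 2 * t * inner ℝ (θ - y) (z - y) + t ^ 2 * ‖z - y‖ ^ 2) / (2 * η) =
        ‖y - θ‖ ^ 2 / (2 * η) - t * (η⁻¹ * inner ℝ (θ - y) (z - y)) +
          t * (t * (‖z - y‖ ^ 2 / (2 * η))) := by
        field_simp
      linarith
    exact le_of_mul_le_mul_left h4 ht0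
  by_contra hcon
  rw [not_le] at hcon
  set A := a + inner ℝ (η⁻¹ • (θ - y)) (z - y) - b with hA
  set B := ‖z - y‖ ^ 2 / (2 * η)
  have hA0 : 0 < A := by linarith
  have hB0 : 0 ≤ B := by positivity
  have h := key (A / (A + B + 1)) (by positivity) ((div_le_one (by positivity)).2 (by linarith))
  rw [div_mul_eq_mul_div, le_div_iff₀ (by positivity)] at h
  nlinarith

theorem add_inner_le_of_mem_subdifferential (hM : M.WellPosed)
    {y z v : EuclideanSpace ℝ (Fin n)} (hv : v ∈ M.subdifferential y)
    (hy : M.regularizer y ≠ ⊤) (hz : M.regularizer z ≠ ⊤) :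
    (M.regularizer y).toReal + inner ℝ v (z - y) ≤ (M.regularizer z).toReal := by
  have h := hv z
  rw [← coe_toReal_regularizer hM hy, ← coe_toReal_regularizer hM hz] at h
  exact_mod_cast h

/-- The proximal map is nonexpansive, because the subdifferential is monotone. -/
theorem lipschitzWith_prox (hM : M.WellPosed) (hR : M.BoundedReward U Dg Dh) (hη : 0 < η) :
    LipschitzWith 1 (M.prox η) := by
  refine LipschitzWith.of_dist_le_mul fun x₁ x₂ => ?_
  rw [NNReal.coe_one, one_mul, dist_eq_norm, dist_eq_norm]
  have ht₁ := regularizer_prox_ne_top hM hR hη x₁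
  have ht₂ := regularizer_prox_ne_top hM hR hη x₂
  have h₁ := add_inner_le_of_mem_subdifferential hM
    (smul_sub_prox_mem_subdifferential hM hR hη x₁) ht₁ ht₂
  have h₂ := add_inner_le_of_mem_subdifferential hM
    (smul_sub_prox_mem_subdifferential hM hR hη x₂) ht₂ ht₁
  set y₁ := M.prox η x₁
  set y₂ := M.prox η x₂
  rw [real_inner_smul_left] at h₁ h₂
  have h3 : η⁻¹ * (inner ℝ (x₁ - y₁) (y₂ - y₁) + inner ℝ (x₂ - y₂) (y₁ - y₂)) ≤ 0 := by linarith
  have h4 : inner ℝ (x₁ - y₁) (y₂ - y₁) + inner ℝ (x₂ - y₂) (y₁ - y₂) ≤ 0 := by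
    by_contra hcon
    exact absurd h3 (not_le.2 (mul_pos (inv_pos.2 hη) (not_le.1 hcon)))
  have h5 : inner ℝ (x₁ - y₁) (y₂ - y₁) + inner ℝ (x₂ - y₂) (y₁ - y₂) =
      ‖y₁ - y₂‖ ^ 2 - inner ℝ (x₁ - x₂) (y₁ - y₂) := by
    rw [← real_inner_self_eq_norm_sq, ← neg_sub y₁ y₂, inner_neg_right, ← sub_eq_neg_add,
      ← inner_sub_left, ← inner_sub_left]
    congr 1
    abel
  have h6 := real_inner_le_norm (x₁ - x₂) (y₁ - y₂)
  by_contra hcon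
  rw [not_le] at hcon
  nlinarith [norm_nonneg (x₁ - x₂)]

theorem differentiable_expectedReward (hM : M.WellPosed) (hR : M.BoundedReward U Dg Dh)
    (hS : M.BoundedScore Cg Ch) : Differentiable ℝ M.expectedReward := fun θ =>
  (hasGradientAt_expectedReward hM hR hS θ).differentiableAt

/-- The suboptimality `F* - F(θ)`, with value `∞` outside the domain of the regularizer. -/
noncomputable def suboptimality (M : RewardProblem n X) (θ : EuclideanSpace ℝ (Fin n)) : ℝ≥0∞ :=
  (M.optimalValue - M.objective θ).toENNReal

theorem suboptimality_eq_top (hM : M.WellPosed) {θ : EuclideanSpace ℝ (Fin n)}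
    (h : M.regularizer θ = ⊤) : M.suboptimality θ = ⊤ := by
  rw [suboptimality, objective, h, EReal.sub_top, EReal.sub_bot hM.optimalValue_finite.1,
    EReal.toENNReal_top]

theorem suboptimality_eq_ofReal (hM : M.WellPosed) {θ : EuclideanSpace ℝ (Fin n)}
    (h : M.regularizer θ ≠ ⊤) : M.suboptimality θ = ENNReal.ofReal
      (M.optimalValue.toReal - (M.expectedReward θ - (M.regularizer θ).toReal)) := by
  rw [suboptimality, objective, ← coe_toReal_regularizer hM h,
    ← EReal.coe_toReal hM.optimalValue_finite.2 hM.optimalValue_finite.1]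
  norm_cast

theorem sub_le_toReal_optimalValue (hM : M.WellPosed) {θ : EuclideanSpace ℝ (Fin n)}
    (h : M.regularizer θ ≠ ⊤) :
    M.expectedReward θ - (M.regularizer θ).toReal ≤ M.optimalValue.toReal := by
  have h1 : M.objective θ ≤ M.optimalValue := le_iSup M.objective θ
  rw [objective, ← coe_toReal_regularizer hM h,
    ← EReal.coe_toReal hM.optimalValue_finite.2 hM.optimalValue_finite.1] at h1
  exact_mod_cast h1

/-- One proximal step with an inexact gradient `g` decreases the suboptimality by a multiple of the
squared step length, up to the squared error of `g`. -/
theorem suboptimality_prox_add_le (hM : M.WellPosed) (hR : M.BoundedReward U Dg Dh)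
    (hS : M.BoundedScore Cg Ch) (hη : 0 < η) {L : ℝ} (hL : 0 < L) (hLη : η * L ≤ 1)
    (hLip : ∀ a b, ‖gradient M.expectedReward a - gradient M.expectedReward b‖ ≤ L * ‖a - b‖)
    (θ g : EuclideanSpace ℝ (Fin n)) :
    M.suboptimality (M.prox η (θ + η • g)) +
        ENNReal.ofReal ((1 / η - L) * ‖M.prox η (θ + η • g) - θ‖ ^ 2) ≤
      M.suboptimality θ + ENNReal.ofReal (‖g - gradient M.expectedReward θ‖ ^ 2 / (2 * L)) := by
  by_cases hθ : M.regularizer θ = ⊤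
  · rw [suboptimality_eq_top hM hθ, top_add]
    exact le_top
  have hyt := regularizer_prox_ne_top hM hR hη (θ + η • g)
  have hsub := add_inner_le_of_mem_subdifferential hM
    (smul_sub_prox_mem_subdifferential hM hR hη (θ + η • g)) hyt hθ
  set y := M.prox η (θ + η • g) with hy
  have hA : 0 ≤ 1 / η - L := by
    rw [sub_nonneg, le_div_iff₀ hη]
    linarith
  have hy0 := sub_le_toReal_optimalValue hM hyt
  have hθ0 := sub_le_toReal_optimalValue hM hθ
  rw [suboptimality_eq_ofReal hM hθ, suboptimality_eq_ofReal hM hyt,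
    ← ENNReal.ofReal_add (by linarith) (by positivity),
    ← ENNReal.ofReal_add (by linarith) (by positivity)]
  refine ENNReal.ofReal_le_ofReal ?_
  have hdesc := add_inner_sub_le_of_lipschitz_gradient
    (differentiable_expectedReward hM hR hS) hLip θ y
  set d := y - θ with hd
  set e := g - gradient M.expectedReward θ with he
  have h1 : inner ℝ (η⁻¹ • (θ + η • g - y)) (θ - y) = ‖d‖ ^ 2 / η - inner ℝ g d := by
    have h2 : θ + η • g - y = η • g - d := by rw [hd]; abel
    have h3 : θ - y = -d := by rw [hd]; abel
    rw [h2, h3, smul_sub, smul_smul, inv_mul_cancel₀ hη.ne', one_smul, inner_neg_right,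
      inner_sub_left, real_inner_smul_left, real_inner_self_eq_norm_sq]
    ring
  rw [h1] at hsub
  have h4 : inner ℝ (gradient M.expectedReward θ) d = inner ℝ g d - inner ℝ e d := by
    rw [← inner_sub_left, he, sub_sub_cancel]
  rw [h4] at hdesc
  -- Young's inequality with the weight `L`
  have h5 : inner ℝ e d ≤ ‖e‖ ^ 2 / (2 * L) + L / 2 * ‖d‖ ^ 2 := by
    have h6 := real_inner_le_norm e d
    have h7 : ‖e‖ ^ 2 / (2 * L) + L / 2 * ‖d‖ ^ 2 - ‖e‖ * ‖d‖ = (‖e‖ - L * ‖d‖) ^ 2 / (2 * L) := by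
      field_simp
      ring
    have h8 : 0 ≤ (‖e‖ - L * ‖d‖) ^ 2 / (2 * L) := by positivity
    linarith
  have h9 : (1 / η - L) * ‖d‖ ^ 2 = ‖d‖ ^ 2 / η - L * ‖d‖ ^ 2 := by ring
  linarith

/-- After a proximal step with an inexact gradient `g`, the stationarity gap is controlled by the
error of `g` and the step length. -/
theorem stationarityGap_prox_sq_le (hM : M.WellPosed) (hR : M.BoundedReward U Dg Dh)
    (hη : 0 < η) {L : ℝ}
    (hLip : ∀ a b, ‖gradient M.expectedReward a - gradient M.expectedReward b‖ ≤ L * ‖a - b‖)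
    (θ g : EuclideanSpace ℝ (Fin n)) :
    M.stationarityGap (M.prox η (θ + η • g)) ^ 2 ≤
      ENNReal.ofReal (2 * ‖g - gradient M.expectedReward θ‖ ^ 2 +
        2 * (L + 1 / η) ^ 2 * ‖M.prox η (θ + η • g) - θ‖ ^ 2) := by
  have hsub := smul_sub_prox_mem_subdifferential hM hR hη (θ + η • g)
  set y := M.prox η (θ + η • g) with hy
  set v := η⁻¹ • (θ + η • g - y) with hv
  have h1 : M.stationarityGap y ≤ ENNReal.ofReal ‖-gradient M.expectedReward y + v‖ := by
    refine (Metric.infEDist_le_edist_of_mem (Set.mem_image_of_mem _ hsub)).trans_eq ?_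
    rw [edist_dist, dist_zero_left]
  have h2 : -gradient M.expectedReward y + v = (g - gradient M.expectedReward θ) +
      ((gradient M.expectedReward θ - gradient M.expectedReward y) - η⁻¹ • (y - θ)) := by
    have h3 : θ + η • g - y = η • g - (y - θ) := by abel
    rw [hv, h3, smul_sub, smul_smul, inv_mul_cancel₀ hη.ne', one_smul]
    abel
  have h3 : ‖-gradient M.expectedReward y + v‖ ≤ ‖g - gradient M.expectedReward θ‖ +
      (L + 1 / η) * ‖y - θ‖ := by
    rw [h2]
    refine (norm_add_le _ _).trans (add_le_add_right ((norm_sub_le _ _).trans ?_) _)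
    rw [norm_smul, Real.norm_of_nonneg (inv_nonneg.2 hη.le), add_mul, one_div]
    refine add_le_add_left ((hLip θ y).trans_eq ?_) _
    rw [norm_sub_rev]
  calc M.stationarityGap y ^ 2 ≤ ENNReal.ofReal ‖-gradient M.expectedReward y + v‖ ^ 2 := by
        gcongr
    _ = ENNReal.ofReal (‖-gradient M.expectedReward y + v‖ ^ 2) :=
        (ENNReal.ofReal_pow (norm_nonneg _) 2).symm
    _ ≤ _ := by
        refine ENNReal.ofReal_le_ofReal ((pow_le_pow_left₀ (norm_nonneg _) h3 2).trans
          (add_sq_le.trans_eq ?_))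
        ring

end RewardProblem

/-! ### The Markov chain of the method -/

/-- The image of a measurably parametrized probability measure under a jointly measurable map
depends measurably on the parameter. -/
theorem measurable_map_of_measurable_prod {α β γ : Type*} [MeasurableSpace α] [MeasurableSpace β]
    [MeasurableSpace γ] {κ : α → Measure β} (hκ : Measurable κ)
    (hprob : ∀ a, IsProbabilityMeasure (κ a)) {f : α → β → γ}
    (hf : Measurable (Function.uncurry f)) : Measurable fun a => (κ a).map (f a) := by
  refine Measure.measurable_of_measurable_coe _ fun s hs => ?_
  let k : ProbabilityTheory.Kernel α β := ⟨κ, hκ⟩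
  have : ProbabilityTheory.IsMarkovKernel k := ⟨hprob⟩
  have h := ProbabilityTheory.Kernel.measurable_kernel_prodMk_left (κ := k) (hf hs)
  have heq : (fun a => (κ a).map (f a) s) =
      fun a => k a (Prod.mk a ⁻¹' (Function.uncurry f ⁻¹' s)) := by
    ext a
    exact Measure.map_apply (hf.comp measurable_prodMk_left) hs
  rwa [heq]

namespace RewardProblem

variable {n : ℕ} {X : Type*} [MeasurableSpace X] {M : RewardProblem n X}
  {U Cg Ch Dg Dh Cw η p : ℝ} {N N₁ N₂ : ℕ}

section Measurability

theorem measurable_density_uncurry (hM : M.WellPosed) (hS : M.BoundedScore Cg Ch) :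
    Measurable (Function.uncurry M.density) := by
  refine measurable_uncurry_of_continuous_of_measurable (fun x => ?_) hM.density_measurable
  have h : (fun θ => M.density θ x) = fun θ => Real.exp (Real.log (M.density θ x)) := by
    ext θ
    rw [Real.exp_log (hM.density_pos θ x)]
  rw [h]
  exact Real.continuous_exp.comp (hS.differentiable x).continuous

theorem measurable_sampleGrad_uncurry (hM : M.WellPosed) (hR : M.BoundedReward U Dg Dh)
    (hS : M.BoundedScore Cg Ch) :
    Measurable (Function.uncurry fun θ x => M.sampleGrad x θ) :=
  measurable_uncurry_of_continuous_of_measurable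
    (fun x => (((differentiable_reward hR x).continuous.smul
      (hS.score_differentiable x).continuous).add (differentiable_rewardGrad hR x).continuous))
    (measurable_sampleGrad hM hR hS)

theorem measurable_policy (hM : M.WellPosed) (hS : M.BoundedScore Cg Ch) :
    Measurable M.policy := by
  refine Measure.measurable_of_measurable_coe _ fun s hs => ?_
  have := hM.policy_prob 0
  have h : ∀ θ, M.policy θ s =
      ∫⁻ x in s, ENNReal.ofReal (M.importanceWeight x θ 0) ∂M.policy 0 := fun θ => by
    rw [policy_eq_withDensity hM θ 0, withDensity_apply _ hs]
  simp only [h]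
  refine Measurable.lintegral_prod_right
    (f := fun θ x => ENNReal.ofReal (M.importanceWeight x θ 0)) ?_
  exact ((measurable_density_uncurry hM hS).div
    ((hM.density_measurable 0).comp measurable_snd)).ennreal_ofReal

theorem isProbabilityMeasure_batchLaw (hM : M.WellPosed) (θ : EuclideanSpace ℝ (Fin n)) :
    IsProbabilityMeasure (M.batchLaw N θ) := by
  have := hM.policy_prob θ
  unfold batchLaw
  infer_instance

theorem measurable_batchLaw (hM : M.WellPosed) (hS : M.BoundedScore Cg Ch) :
    Measurable (M.batchLaw N) := by
  have := fun θ => isProbabilityMeasure_batchLaw (N := N) hM θ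
  refine Measurable.measure_of_isPiSystem_of_isProbabilityMeasure generateFrom_pi.symm
    isPiSystem_pi ?_
  rintro _ ⟨s, hs, rfl⟩
  have h : ∀ θ, M.batchLaw N θ (Set.univ.pi s) = ∏ j, M.policy θ (s j) := fun θ => by
    have := hM.policy_prob θ
    exact Measure.pi_pi _ _
  simp only [h]
  exact Finset.measurable_prod _ fun j _ =>
    (Measure.measurable_coe (hs j (Set.mem_univ j))).comp (measurable_policy hM hS)

theorem measurable_fullEstimator_uncurry (hM : M.WellPosed) (hR : M.BoundedReward U Dg Dh)
    (hS : M.BoundedScore Cg Ch) :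
    Measurable (Function.uncurry fun θ (x : Fin N → X) => M.fullEstimator x θ) := by
  refine Measurable.const_smul (Finset.measurable_sum _ fun j _ => ?_) (N : ℝ)⁻¹
  exact (measurable_sampleGrad_uncurry hM hR hS).comp
    (measurable_fst.prodMk ((measurable_pi_apply j).comp measurable_snd))

theorem measurable_weightedGrad_uncurry (hM : M.WellPosed) (hR : M.BoundedReward U Dg Dh)
    (hS : M.BoundedScore Cg Ch) :
    Measurable fun q : (EuclideanSpace ℝ (Fin n) × EuclideanSpace ℝ (Fin n)) × X =>
      M.weightedGrad q.2 q.1.1 q.1.2 := by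
  have h1 : Measurable fun q : (EuclideanSpace ℝ (Fin n) × EuclideanSpace ℝ (Fin n)) × X =>
      (q.1.1, q.2) := by fun_prop
  have h2 : Measurable fun q : (EuclideanSpace ℝ (Fin n) × EuclideanSpace ℝ (Fin n)) × X =>
      (q.1.2, q.2) := by fun_prop
  exact (((measurable_density_uncurry hM hS).comp h1).div
    ((measurable_density_uncurry hM hS).comp h2)).smul
      ((measurable_sampleGrad_uncurry hM hR hS).comp h1)

theorem measurable_recursiveEstimator_uncurry (hM : M.WellPosed) (hR : M.BoundedReward U Dg Dh)
    (hS : M.BoundedScore Cg Ch) :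
    Measurable fun q : ((EuclideanSpace ℝ (Fin n) × EuclideanSpace ℝ (Fin n)) ×
        EuclideanSpace ℝ (Fin n)) × (Fin N → X) =>
      M.recursiveEstimator q.2 q.1.1.1 q.1.1.2 q.1.2 := by
  refine Measurable.add (Measurable.sub ?_ ?_) (measurable_snd.comp measurable_fst)
  · exact (measurable_fullEstimator_uncurry hM hR hS).comp (f := fun q :
      ((EuclideanSpace ℝ (Fin n) × EuclideanSpace ℝ (Fin n)) ×
        EuclideanSpace ℝ (Fin n)) × (Fin N → X) => (q.1.1.2, q.2)) (by fun_prop)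
  · refine Measurable.const_smul (Finset.measurable_sum _ fun j _ => ?_) (N : ℝ)⁻¹
    exact (measurable_weightedGrad_uncurry hM hR hS).comp (f := fun q :
      ((EuclideanSpace ℝ (Fin n) × EuclideanSpace ℝ (Fin n)) ×
        EuclideanSpace ℝ (Fin n)) × (Fin N → X) => (q.1.1, q.2 j)) (by fun_prop)

theorem measurable_nextIterate (hM : M.WellPosed) (hR : M.BoundedReward U Dg Dh) (hη : 0 < η) :
    Measurable fun s : State n => M.prox η (s.1 + η • s.2.1) :=
  (lipschitzWith_prox hM hR hη).continuous.measurable.comp (by fun_prop)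

theorem measurable_fullUpdate_uncurry (hM : M.WellPosed) (hR : M.BoundedReward U Dg Dh)
    (hS : M.BoundedScore Cg Ch) (hη : 0 < η) :
    Measurable (Function.uncurry fun (s : State n) (x : Fin N → X) =>
      ((M.prox η (s.1 + η • s.2.1), M.fullEstimator x (M.prox η (s.1 + η • s.2.1)),
        s.2.2 + N) : State n)) :=
  have hθ := measurable_nextIterate hM hR hη
  (hθ.comp measurable_fst).prodMk (((measurable_fullEstimator_uncurry hM hR hS).comp
    ((hθ.comp measurable_fst).prodMk measurable_snd)).prodMk
      ((measurable_from_top (f := fun k : ℕ => k + N)).comp (by fun_prop :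
        Measurable fun q : State n × (Fin N → X) => q.1.2.2)))

theorem measurable_recursiveUpdate_uncurry (hM : M.WellPosed) (hR : M.BoundedReward U Dg Dh)
    (hS : M.BoundedScore Cg Ch) (hη : 0 < η) :
    Measurable (Function.uncurry fun (s : State n) (x : Fin N → X) =>
      ((M.prox η (s.1 + η • s.2.1),
        M.recursiveEstimator x s.1 (M.prox η (s.1 + η • s.2.1)) s.2.1, s.2.2 + N) : State n)) :=
  have hθ := measurable_nextIterate hM hR hη
  (hθ.comp measurable_fst).prodMk (((measurable_recursiveEstimator_uncurry hM hR hS).comp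
    ((((by fun_prop : Measurable fun q : State n × (Fin N → X) => q.1.1).prodMk
      (hθ.comp measurable_fst)).prodMk (by fun_prop :
        Measurable fun q : State n × (Fin N → X) => q.1.2.1)).prodMk measurable_snd)).prodMk
      ((measurable_from_top (f := fun k : ℕ => k + N)).comp (by fun_prop :
        Measurable fun q : State n × (Fin N → X) => q.1.2.2)))

/-- The transition of the method is a Markov kernel; without this, `Measure.bind` would return the
zero measure. -/
theorem measurable_pageStep (hM : M.WellPosed) (hR : M.BoundedReward U Dg Dh)
    (hS : M.BoundedScore Cg Ch) (hη : 0 < η) : Measurable (M.pageStep N₁ N₂ p η) := by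
  have hθ := measurable_nextIterate hM hR hη
  have h1 := measurable_map_of_measurable_prod ((measurable_batchLaw hM hS).comp hθ)
    (fun s => isProbabilityMeasure_batchLaw hM _)
    (measurable_fullUpdate_uncurry (N := N₁) hM hR hS hη)
  have h2 := measurable_map_of_measurable_prod ((measurable_batchLaw hM hS).comp hθ)
    (fun s => isProbabilityMeasure_batchLaw hM _)
    (measurable_recursiveUpdate_uncurry (N := N₂) hM hR hS hη)
  refine Measure.measurable_of_measurable_coe _ fun s hs => ?_
  exact (((Measure.measurable_coe hs).comp h1).const_mul (ENNReal.ofReal p)).add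
    (((Measure.measurable_coe hs).comp h2).const_mul (ENNReal.ofReal (1 - p)))

theorem ofReal_add_ofReal_one_sub (hp0 : 0 ≤ p) (hp1 : p ≤ 1) :
    ENNReal.ofReal p + ENNReal.ofReal (1 - p) = 1 := by
  rw [← ENNReal.ofReal_add hp0 (sub_nonneg.2 hp1), add_sub_cancel, ENNReal.ofReal_one]

theorem isProbabilityMeasure_pageStep (hM : M.WellPosed) (hR : M.BoundedReward U Dg Dh)
    (hS : M.BoundedScore Cg Ch) (hη : 0 < η) (hp0 : 0 ≤ p) (hp1 : p ≤ 1) (s : State n) :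
    IsProbabilityMeasure (M.pageStep N₁ N₂ p η s) := by
  have hb := fun (N : ℕ) θ => isProbabilityMeasure_batchLaw (N := N) hM θ
  have h1 := (measurable_fullUpdate_uncurry (N := N₁) hM hR hS hη).comp
    (measurable_prodMk_left (x := s))
  have h2 := (measurable_recursiveUpdate_uncurry (N := N₂) hM hR hS hη).comp
    (measurable_prodMk_left (x := s))
  have h1' := Measure.isProbabilityMeasure_map
    (μ := M.batchLaw N₁ (M.prox η (s.1 + η • s.2.1))) h1.aemeasurable
  have h2' := Measure.isProbabilityMeasure_map
    (μ := M.batchLaw N₂ (M.prox η (s.1 + η • s.2.1))) h2.aemeasurable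
  refine ⟨Eq.trans ?_ (ofReal_add_ofReal_one_sub hp0 hp1)⟩
  rw [pageStep, Measure.add_apply, Measure.smul_apply, Measure.smul_apply]
  exact congrArg₂ (· + ·) ((congrArg _ h1'.measure_univ).trans (mul_one _))
    ((congrArg _ h2'.measure_univ).trans (mul_one _))

theorem isProbabilityMeasure_stateLaw (hM : M.WellPosed) (hR : M.BoundedReward U Dg Dh)
    (hS : M.BoundedScore Cg Ch) (hη : 0 < η) (hp0 : 0 ≤ p) (hp1 : p ≤ 1)
    (θ₀ : EuclideanSpace ℝ (Fin n)) (t : ℕ) :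
    IsProbabilityMeasure (M.stateLaw N₁ N₂ p η θ₀ t) := by
  induction t with
  | zero =>
    have := isProbabilityMeasure_batchLaw (N := N₁) hM θ₀
    refine Measure.isProbabilityMeasure_map (Measurable.aemeasurable ?_)
    exact measurable_const.prodMk (((measurable_fullEstimator_uncurry hM hR hS).comp
      measurable_prodMk_left).prodMk measurable_const)
  | succ t ih =>
    exact isProbabilityMeasure_bind (measurable_pageStep hM hR hS hη).aemeasurable
      (Filter.Eventually.of_forall (isProbabilityMeasure_pageStep hM hR hS hη hp0 hp1))

theorem isProbabilityMeasure_outputLaw (hM : M.WellPosed) (hR : M.BoundedReward U Dg Dh)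
    (hS : M.BoundedScore Cg Ch) (hη : 0 < η) (hp0 : 0 ≤ p) (hp1 : p ≤ 1)
    (θ₀ : EuclideanSpace ℝ (Fin n)) {T : ℕ} (hT : T ≠ 0) :
    IsProbabilityMeasure (M.outputLaw N₁ N₂ p η θ₀ T) := by
  have h : ∀ t, (M.stateLaw N₁ N₂ p η θ₀ t).map Prod.fst Set.univ = 1 := fun t => by
    have := isProbabilityMeasure_stateLaw (N₁ := N₁) (N₂ := N₂) hM hR hS hη hp0 hp1 θ₀ t
    exact (Measure.isProbabilityMeasure_map measurable_fst.aemeasurable).measure_univ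
  refine ⟨?_⟩
  simp only [outputLaw, Measure.smul_apply, Measure.coe_finsetSum, Finset.sum_apply, h,
    Finset.sum_const, Nat.card_Icc, add_tsub_cancel_right, nsmul_eq_mul, mul_one, smul_eq_mul]
  exact ENNReal.inv_mul_cancel (Nat.cast_ne_zero.2 hT) (ENNReal.natCast_ne_top T)

end Measurability

section Recursion

/-- An inequality only, because `f` is not assumed measurable. -/
theorem lintegral_pageStep_le (f : State n → ℝ≥0∞) (s : State n) :
    ∫⁻ s', f s' ∂M.pageStep N₁ N₂ p η s ≤
      ENNReal.ofReal p * ∫⁻ x, f (M.prox η (s.1 + η • s.2.1),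
          M.fullEstimator x (M.prox η (s.1 + η • s.2.1)), s.2.2 + N₁)
          ∂M.batchLaw N₁ (M.prox η (s.1 + η • s.2.1)) +
        ENNReal.ofReal (1 - p) * ∫⁻ x, f (M.prox η (s.1 + η • s.2.1),
          M.recursiveEstimator x s.1 (M.prox η (s.1 + η • s.2.1)) s.2.1, s.2.2 + N₂)
          ∂M.batchLaw N₂ (M.prox η (s.1 + η • s.2.1)) := by
  rw [pageStep, lintegral_add_measure, lintegral_smul_measure, lintegral_smul_measure]
  exact add_le_add (mul_le_mul_right (lintegral_map_le _ _) _)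
    (mul_le_mul_right (lintegral_map_le _ _) _)

theorem lintegral_stateLaw_succ_le (θ₀ : EuclideanSpace ℝ (Fin n)) (t : ℕ)
    {f g : State n → ℝ≥0∞} (h : ∀ s, ∫⁻ s', f s' ∂M.pageStep N₁ N₂ p η s ≤ g s) :
    ∫⁻ s, f s ∂M.stateLaw N₁ N₂ p η θ₀ (t + 1) ≤ ∫⁻ s, g s ∂M.stateLaw N₁ N₂ p η θ₀ t :=
  (Measure.lintegral_bind_le _ _ _).trans (lintegral_mono h)

theorem lintegral_fst_stateLaw_succ_le (hM : M.WellPosed) (hp0 : 0 ≤ p) (hp1 : p ≤ 1)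
    (θ₀ : EuclideanSpace ℝ (Fin n)) (t : ℕ) (f : EuclideanSpace ℝ (Fin n) → ℝ≥0∞) :
    ∫⁻ s, f s.1 ∂M.stateLaw N₁ N₂ p η θ₀ (t + 1) ≤
      ∫⁻ s, f (M.prox η (s.1 + η • s.2.1)) ∂M.stateLaw N₁ N₂ p η θ₀ t := by
  refine lintegral_stateLaw_succ_le (f := fun s => f s.1) θ₀ t fun s =>
    (lintegral_pageStep_le _ s).trans_eq ?_
  have hb := fun (N : ℕ) θ => isProbabilityMeasure_batchLaw (N := N) hM θ
  dsimp only
  rw [lintegral_const, lintegral_const, measure_univ, measure_univ, mul_one, ← add_mul,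
    ofReal_add_ofReal_one_sub hp0 hp1, one_mul]

/-- The mean squared error of the gradient estimator after `t` iterations. -/
noncomputable def meanSqError (M : RewardProblem n X) (N₁ N₂ : ℕ) (p η : ℝ)
    (θ₀ : EuclideanSpace ℝ (Fin n)) (t : ℕ) : ℝ≥0∞ :=
  ∫⁻ s, ENNReal.ofReal (‖s.2.1 - gradient M.expectedReward s.1‖ ^ 2) ∂M.stateLaw N₁ N₂ p η θ₀ t

/-- The mean square of the length `‖θᵗ⁺¹ - θᵗ‖` of the proximal step. -/
noncomputable def meanSqStep (M : RewardProblem n X) (N₁ N₂ : ℕ) (p η : ℝ)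
    (θ₀ : EuclideanSpace ℝ (Fin n)) (t : ℕ) : ℝ≥0∞ :=
  ∫⁻ s, ENNReal.ofReal (‖M.prox η (s.1 + η • s.2.1) - s.1‖ ^ 2) ∂M.stateLaw N₁ N₂ p η θ₀ t

/-- The mean suboptimality `𝔼[F* - F(θᵗ)]`. -/
noncomputable def meanSuboptimality (M : RewardProblem n X) (N₁ N₂ : ℕ) (p η : ℝ)
    (θ₀ : EuclideanSpace ℝ (Fin n)) (t : ℕ) : ℝ≥0∞ :=
  ∫⁻ s, M.suboptimality s.1 ∂M.stateLaw N₁ N₂ p η θ₀ t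

variable {θ₀ : EuclideanSpace ℝ (Fin n)}

theorem meanSqError_zero_le (hM : M.WellPosed) (hR : M.BoundedReward U Dg Dh)
    (hS : M.BoundedScore Cg Ch) (hN₁ : N₁ ≠ 0) :
    M.meanSqError N₁ N₂ p η θ₀ 0 ≤ ENNReal.ofReal ((U * Cg + Dg) ^ 2 / N₁) :=
  (lintegral_map_le _ _).trans (lintegral_fullEstimator_error_le hM hR hS hN₁ θ₀)

theorem continuous_gradient_expectedReward {L : ℝ}
    (hLip : ∀ a b, ‖gradient M.expectedReward a - gradient M.expectedReward b‖ ≤ L * ‖a - b‖) :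
    Continuous (gradient M.expectedReward) := by
  refine (LipschitzWith.of_dist_le_mul (K := L.toNNReal) fun a b => ?_).continuous
  rw [dist_eq_norm, dist_eq_norm]
  exact (hLip a b).trans (mul_le_mul_of_nonneg_right (Real.le_coe_toNNReal L) (norm_nonneg _))

theorem measurable_sq_error {L : ℝ}
    (hLip : ∀ a b, ‖gradient M.expectedReward a - gradient M.expectedReward b‖ ≤ L * ‖a - b‖) :
    Measurable fun s : State n =>
      ENNReal.ofReal (‖s.2.1 - gradient M.expectedReward s.1‖ ^ 2) := by
  have := (continuous_gradient_expectedReward hLip).measurable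
  fun_prop

theorem measurable_sq_step (hM : M.WellPosed) (hR : M.BoundedReward U Dg Dh) (hη : 0 < η) :
    Measurable fun s : State n =>
      ENNReal.ofReal (‖M.prox η (s.1 + η • s.2.1) - s.1‖ ^ 2) :=
  (((measurable_nextIterate hM hR hη).sub measurable_fst).norm.pow_const 2).ennreal_ofReal

/-- The recursion for the estimator error: a restart has error `σ² / N₁`, and a recursive update
adds a term proportional to the squared step length to the previous error. -/
theorem meanSqError_succ_le (hM : M.WellPosed) (hR : M.BoundedReward U Dg Dh)
    (hS : M.BoundedScore Cg Ch) (hW : M.BoundedImportanceWeight Cw)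
    (hU : 0 < U) (hCg : 0 < Cg) (hCh : 0 < Ch) (hDg : 0 < Dg) (hη : 0 < η)
    (hp0 : 0 ≤ p) (hp1 : p ≤ 1) (hN₁ : N₁ ≠ 0) (hN₂ : N₂ ≠ 0) (t : ℕ) :
    M.meanSqError N₁ N₂ p η θ₀ (t + 1) ≤
      ENNReal.ofReal p * ENNReal.ofReal ((U * Cg + Dg) ^ 2 / N₁) +
        ENNReal.ofReal (1 - p) * (M.meanSqError N₁ N₂ p η θ₀ t +
          ENNReal.ofReal (constC U Cg Ch Dg Dh Cw / N₂) * M.meanSqStep N₁ N₂ p η θ₀ t) := by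
  have := isProbabilityMeasure_stateLaw (N₁ := N₁) (N₂ := N₂) hM hR hS hη hp0 hp1 θ₀ t
  have hC : 0 ≤ constC U Cg Ch Dg Dh Cw := by
    unfold constC
    positivity
  have hLip := norm_gradient_expectedReward_sub_le hM hR hS hU hCg hDg
  have hme := measurable_sq_error hLip
  have hms := measurable_sq_step hM hR hη
  refine (lintegral_stateLaw_succ_le (g := fun s =>
    ENNReal.ofReal p * ENNReal.ofReal ((U * Cg + Dg) ^ 2 / N₁) + ENNReal.ofReal (1 - p) *
      (ENNReal.ofReal (‖s.2.1 - gradient M.expectedReward s.1‖ ^ 2) +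
        ENNReal.ofReal (constC U Cg Ch Dg Dh Cw / N₂) *
          ENNReal.ofReal (‖M.prox η (s.1 + η • s.2.1) - s.1‖ ^ 2))) θ₀ t fun s => ?_).trans_eq ?_
  · refine (lintegral_pageStep_le _ s).trans (add_le_add (mul_le_mul_right
      (lintegral_fullEstimator_error_le hM hR hS hN₁ _) _) (mul_le_mul_right
      ((lintegral_recursiveEstimator_error_le hM hR hS hW hU hCg hCh hDg hN₂ _ _ _).trans_eq ?_) _))
    rw [← ENNReal.ofReal_mul (by positivity), ← ENNReal.ofReal_add (by positivity) (by positivity),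
      div_mul_eq_mul_div]
  · have hsum : Measurable fun s : State n =>
        ENNReal.ofReal (‖s.2.1 - gradient M.expectedReward s.1‖ ^ 2) +
          ENNReal.ofReal (constC U Cg Ch Dg Dh Cw / N₂) *
            ENNReal.ofReal (‖M.prox η (s.1 + η • s.2.1) - s.1‖ ^ 2) :=
      hme.add (hms.const_mul _)
    rw [lintegral_add_left measurable_const, lintegral_const, measure_univ, mul_one,
      lintegral_const_mul _ hsum, lintegral_add_left hme, lintegral_const_mul _ hms]
    rfl

theorem meanSuboptimality_zero_le {Δ : ℝ} (hΔ : M.optimalValue - M.objective θ₀ ≤ (Δ : EReal))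
    (hM : M.WellPosed) :
    M.meanSuboptimality N₁ N₂ p η θ₀ 0 ≤ ENNReal.ofReal Δ := by
  have := isProbabilityMeasure_batchLaw (N := N₁) hM θ₀
  refine (lintegral_map_le _ _).trans ?_
  dsimp only
  rw [lintegral_const, measure_univ, mul_one]
  exact EReal.toENNReal_le_toENNReal hΔ

theorem meanSuboptimality_succ_add_le (hM : M.WellPosed) (hR : M.BoundedReward U Dg Dh)
    (hS : M.BoundedScore Cg Ch) (hη : 0 < η) {L : ℝ} (hL : 0 < L) (hLη : η * L ≤ 1)
    (hLip : ∀ a b, ‖gradient M.expectedReward a - gradient M.expectedReward b‖ ≤ L * ‖a - b‖)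
    (hp0 : 0 ≤ p) (hp1 : p ≤ 1) (t : ℕ) :
    M.meanSuboptimality N₁ N₂ p η θ₀ (t + 1) +
        ENNReal.ofReal (1 / η - L) * M.meanSqStep N₁ N₂ p η θ₀ t ≤
      M.meanSuboptimality N₁ N₂ p η θ₀ t +
        ENNReal.ofReal (1 / (2 * L)) * M.meanSqError N₁ N₂ p η θ₀ t := by
  have hme := measurable_sq_error hLip
  have hms := measurable_sq_step hM hR hη
  have hA : 0 ≤ 1 / η - L := by
    rw [sub_nonneg, le_div_iff₀ hη]
    linarith
  refine (add_le_add_left (lintegral_fst_stateLaw_succ_le hM hp0 hp1 θ₀ t _) _).trans ?_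
  rw [meanSuboptimality, meanSqStep, meanSqError, ← lintegral_const_mul _ hms,
    ← lintegral_const_mul _ hme, ← lintegral_add_right _ (hms.const_mul _),
    ← lintegral_add_right _ (hme.const_mul _)]
  refine lintegral_mono fun s => ?_
  have h := suboptimality_prox_add_le hM hR hS hη hL hLη hLip s.1 s.2.1
  rw [← ENNReal.ofReal_mul hA, ← ENNReal.ofReal_mul (by positivity), one_div_mul_eq_div]
  exact h

theorem lintegral_stationarityGap_stateLaw_succ_le (hM : M.WellPosed)
    (hR : M.BoundedReward U Dg Dh) (hη : 0 < η) {L : ℝ}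
    (hLip : ∀ a b, ‖gradient M.expectedReward a - gradient M.expectedReward b‖ ≤ L * ‖a - b‖)
    (hp0 : 0 ≤ p) (hp1 : p ≤ 1) (t : ℕ) :
    ∫⁻ s, M.stationarityGap s.1 ^ 2 ∂M.stateLaw N₁ N₂ p η θ₀ (t + 1) ≤
      ENNReal.ofReal 2 * M.meanSqError N₁ N₂ p η θ₀ t +
        ENNReal.ofReal (2 * (L + 1 / η) ^ 2) * M.meanSqStep N₁ N₂ p η θ₀ t := by
  have hme := measurable_sq_error hLip
  have hms := measurable_sq_step hM hR hη
  refine (lintegral_fst_stateLaw_succ_le hM hp0 hp1 θ₀ t fun θ => M.stationarityGap θ ^ 2).trans ?_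
  rw [meanSqStep, meanSqError, ← lintegral_const_mul _ hms, ← lintegral_const_mul _ hme,
    ← lintegral_add_right _ (hms.const_mul _)]
  refine lintegral_mono fun s => ?_
  rw [← ENNReal.ofReal_mul (by positivity), ← ENNReal.ofReal_mul (by positivity),
    ← ENNReal.ofReal_add (by positivity) (by positivity)]
  exact stationarityGap_prox_sq_le hM hR hη hLip s.1 s.2.1

theorem lintegral_outputLaw_le (f : EuclideanSpace ℝ (Fin n) → ℝ≥0∞) (T : ℕ) :
    ∫⁻ θ, f θ ∂M.outputLaw N₁ N₂ p η θ₀ T ≤ (T : ℝ≥0∞)⁻¹ *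
      ∑ t ∈ Finset.range T, ∫⁻ s, f s.1 ∂M.stateLaw N₁ N₂ p η θ₀ (t + 1) := by
  rw [outputLaw, lintegral_smul_measure, lintegral_finsetSum_measure, smul_eq_mul,
    Finset.range_eq_Ico, Finset.sum_Ico_add' (fun t =>
      ∫⁻ s, f s.1 ∂M.stateLaw N₁ N₂ p η θ₀ t) 0 T 1]
  exact mul_le_mul_right (Finset.sum_le_sum fun t _ => lintegral_map_le _ _) _

theorem expectedSamples_le (hM : M.WellPosed) (hR : M.BoundedReward U Dg Dh)
    (hS : M.BoundedScore Cg Ch) (hη : 0 < η) (hp0 : 0 ≤ p) (hp1 : p ≤ 1) (T : ℕ) :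
    M.expectedSamples N₁ N₂ p η θ₀ T ≤
      ENNReal.ofReal (N₁ + T * (p * N₁ + (1 - p) * N₂)) := by
  have hb := fun (N : ℕ) θ => isProbabilityMeasure_batchLaw (N := N) hM θ
  have hq : 0 ≤ 1 - p := sub_nonneg.2 hp1
  induction T with
  | zero =>
    refine (lintegral_map_le _ _).trans ?_
    dsimp only
    rw [lintegral_const, measure_univ, mul_one]
    simp
  | succ t ih =>
    have := isProbabilityMeasure_stateLaw (N₁ := N₁) (N₂ := N₂) hM hR hS hη hp0 hp1 θ₀ t
    refine (lintegral_stateLaw_succ_le (f := fun s => (s.2.2 : ℝ≥0∞))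
      (g := fun s => s.2.2 + ENNReal.ofReal (p * N₁ + (1 - p) * N₂)) θ₀ t fun s => ?_).trans ?_
    · refine (lintegral_pageStep_le _ s).trans_eq ?_
      dsimp only
      rw [lintegral_const, lintegral_const, measure_univ, measure_univ, mul_one, mul_one,
        ENNReal.ofReal_add (by positivity) (by positivity), ENNReal.ofReal_mul hp0,
        ENNReal.ofReal_mul hq, ENNReal.ofReal_natCast, ENNReal.ofReal_natCast, Nat.cast_add,
        Nat.cast_add]
      calc _ = (ENNReal.ofReal p + ENNReal.ofReal (1 - p)) * (s.2.2 : ℝ≥0∞) +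
            (ENNReal.ofReal p * N₁ + ENNReal.ofReal (1 - p) * N₂) := by ring
        _ = _ := by rw [ofReal_add_ofReal_one_sub hp0 hp1, one_mul]
    · rw [lintegral_add_right _ measurable_const, lintegral_const, measure_univ, mul_one]
      refine (add_le_add_left ih _).trans_eq ?_
      rw [← ENNReal.ofReal_add (by positivity) (by positivity)]
      congr 1
      push_cast
      ring

end Recursion

end RewardProblem

/-! ### Summation of the recursions -/

/-- Summation of the recursions for the estimator error `e`, the squared step length `d` and the
suboptimality `φ`, with restart probability `1 / (N + 1)` and batch sizes `N²` and `N`. The choice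
of the restart probability makes the accumulated error at most `C ∑ d` plus the contribution of the
restarts, and the descent of `φ` absorbs `C ∑ d`. -/
theorem sum_le_of_error_and_descent_recursion {e d φ : ℕ → ℝ} {N L A B C v Δ : ℝ}
    (hN : 0 < N) (hL : 0 < L) (hC : 0 ≤ C) (hB : 0 ≤ B) (hA : L + 2 * C / L ≤ A)
    (he0 : ∀ t, 0 ≤ e t) (hd0 : ∀ t, 0 ≤ d t) (hφ0 : ∀ t, 0 ≤ φ t)
    (he : e 0 ≤ v / N ^ 2) (hφ : φ 0 ≤ Δ)
    (hes : ∀ t, e (t + 1) ≤ 1 / (N + 1) * (v / N ^ 2) + N / (N + 1) * (e t + C / N * d t))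
    (hφs : ∀ t, φ (t + 1) + A * d t ≤ φ t + 1 / (2 * L) * e t) (T : ℕ) :
    ∑ t ∈ Finset.range T, (2 * e t + B * d t) ≤
      (2 + (2 * C + B) / L / (2 * L)) * (v * ((N + 1) / N ^ 2) + v * T / N ^ 2) +
        (2 * C + B) / L * Δ := by
  set SE := ∑ t ∈ Finset.range T, e t with hSE
  set SD := ∑ t ∈ Finset.range T, d t with hSD
  have hSD0 : 0 ≤ SD := Finset.sum_nonneg fun t _ => hd0 t
  set S := v * ((N + 1) / N ^ 2) + v * T / N ^ 2 with hS
  have h1 : SE ≤ S + C * SD := by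
    have h : ∀ T : ℕ, ∑ t ∈ Finset.range T, e t + (N + 1) * e T ≤
        (N + 1) * (v / N ^ 2) + v * T / N ^ 2 + C * ∑ t ∈ Finset.range T, d t := by
      intro T
      induction T with
      | zero =>
        have h2 := mul_le_mul_of_nonneg_left he (by positivity : 0 ≤ N + 1)
        simpa using h2
      | succ t ih =>
        rw [Finset.sum_range_succ, Finset.sum_range_succ]
        have h2 := mul_le_mul_of_nonneg_left (hes t) (by positivity : 0 ≤ N + 1)
        have h3 : (N + 1) * (1 / (N + 1) * (v / N ^ 2) + N / (N + 1) * (e t + C / N * d t)) =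
            v / N ^ 2 + N * e t + C * d t := by
          field_simp
          ring
        have h4 : v * ((t + 1 : ℕ) : ℝ) / N ^ 2 = v * t / N ^ 2 + v / N ^ 2 := by
          push_cast
          ring
        rw [h4]
        linarith
    have h2 := h T
    have h3 : 0 ≤ (N + 1) * e T := mul_nonneg (by positivity) (he0 T)
    have h4 : (N + 1) * (v / N ^ 2) = v * ((N + 1) / N ^ 2) := by ring
    linarith
  have h2 : A * SD ≤ Δ + 1 / (2 * L) * SE := by
    have h : ∀ T : ℕ, φ T + A * ∑ t ∈ Finset.range T, d t ≤
        Δ + 1 / (2 * L) * ∑ t ∈ Finset.range T, e t := by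
      intro T
      induction T with
      | zero => simpa using hφ
      | succ t ih =>
        rw [Finset.sum_range_succ, Finset.sum_range_succ]
        linarith [hφs t]
    linarith [h T, hφ0 T]
  have h3 : L * SD ≤ Δ + S / (2 * L) := by
    have h4 : (L + 2 * C / L) * SD ≤ A * SD := mul_le_mul_of_nonneg_right hA hSD0
    have h5 : 1 / (2 * L) * SE ≤ 1 / (2 * L) * (S + C * SD) :=
      mul_le_mul_of_nonneg_left h1 (by positivity)
    have h6 : 1 / (2 * L) * (S + C * SD) = S / (2 * L) + C / L * SD / 2 := by
      field_simp
    have h7 : (L + 2 * C / L) * SD = L * SD + 2 * (C / L * SD) := by ring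
    have h8 : 0 ≤ C / L * SD := by positivity
    linarith
  rw [Finset.sum_add_distrib, ← Finset.mul_sum, ← Finset.mul_sum]
  have h4 : (2 * C + B) / L * (L * SD) ≤ (2 * C + B) / L * (Δ + S / (2 * L)) :=
    mul_le_mul_of_nonneg_left h3 (by positivity)
  have h5 : (2 * C + B) / L * (L * SD) = (2 * C + B) * SD := by field_simp
  have h6 : (2 + (2 * C + B) / L / (2 * L)) * S + (2 * C + B) / L * Δ =
      2 * S + (2 * C + B) / L * (Δ + S / (2 * L)) := by ring
  rw [h6]
  linarith

/-- The version of `sum_le_of_error_and_descent_recursion` for a priori possibly infinite sequences: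
the recursions keep them finite. -/
theorem sum_le_of_error_and_descent_recursion_ennreal {e d φ : ℕ → ℝ≥0∞} {N L A B C v Δ : ℝ}
    (hN : 0 < N) (hL : 0 < L) (hC : 0 ≤ C) (hB : 0 ≤ B) (hv : 0 ≤ v) (hΔ : 0 ≤ Δ)
    (hA : L + 2 * C / L ≤ A)
    (he : e 0 ≤ ENNReal.ofReal (v / N ^ 2)) (hφ : φ 0 ≤ ENNReal.ofReal Δ)
    (hes : ∀ t, e (t + 1) ≤ ENNReal.ofReal (1 / (N + 1)) * ENNReal.ofReal (v / N ^ 2) +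
      ENNReal.ofReal (N / (N + 1)) * (e t + ENNReal.ofReal (C / N) * d t))
    (hφs : ∀ t, φ (t + 1) + ENNReal.ofReal A * d t ≤ φ t + ENNReal.ofReal (1 / (2 * L)) * e t)
    (T : ℕ) :
    ∑ t ∈ Finset.range T, (ENNReal.ofReal 2 * e t + ENNReal.ofReal B * d t) ≤
      ENNReal.ofReal ((2 + (2 * C + B) / L / (2 * L)) *
        (v * ((N + 1) / N ^ 2) + v * T / N ^ 2) + (2 * C + B) / L * Δ) := by
  have hA0 : 0 < A := lt_of_lt_of_le (by positivity) hA
  have hdfin : ∀ t, e t ≠ ⊤ → φ t ≠ ⊤ → d t ≠ ⊤ := by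
    intro t h1 h2 h3
    have h := hφs t
    rw [h3, ENNReal.mul_top (ENNReal.ofReal_pos.2 hA0).ne', add_top, top_le_iff] at h
    exact ENNReal.add_ne_top.2 ⟨h2, ENNReal.mul_ne_top ENNReal.ofReal_ne_top h1⟩ h
  have hfin : ∀ t, e t ≠ ⊤ ∧ φ t ≠ ⊤ := by
    intro t
    induction t with
    | zero => exact ⟨ne_top_of_le_ne_top ENNReal.ofReal_ne_top he,
        ne_top_of_le_ne_top ENNReal.ofReal_ne_top hφ⟩
    | succ t ih =>
      have hd := hdfin t ih.1 ih.2
      refine ⟨ne_top_of_le_ne_top ?_ (hes t), ne_top_of_le_ne_top ?_ (le_self_add.trans (hφs t))⟩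
      · exact ENNReal.add_ne_top.2 ⟨ENNReal.mul_ne_top ENNReal.ofReal_ne_top ENNReal.ofReal_ne_top,
          ENNReal.mul_ne_top ENNReal.ofReal_ne_top (ENNReal.add_ne_top.2
            ⟨ih.1, ENNReal.mul_ne_top ENNReal.ofReal_ne_top hd⟩)⟩
      · exact ENNReal.add_ne_top.2 ⟨ih.2, ENNReal.mul_ne_top ENNReal.ofReal_ne_top ih.1⟩
  lift e to ℕ → NNReal using fun t => (hfin t).1
  lift φ to ℕ → NNReal using fun t => (hfin t).2
  lift d to ℕ → NNReal using fun t => hdfin t (hfin t).1 (hfin t).2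
  beta_reduce at he hφ hes hφs
  have hcoe : ∀ {c : ℝ} (x : NNReal), 0 ≤ c →
      ENNReal.ofReal c * (x : ℝ≥0∞) = ENNReal.ofReal (c * x) := fun x hc => by
    rw [ENNReal.ofReal_mul hc, ENNReal.ofReal_coe_nnreal]
  have h := sum_le_of_error_and_descent_recursion (e := fun t => e t) (d := fun t => d t)
    (φ := fun t => φ t) (v := v) (Δ := Δ) hN hL hC hB hA (fun t => (e t).2) (fun t => (d t).2)
    (fun t => (φ t).2) ?_ ?_ ?_ ?_ T
  · refine le_trans (le_of_eq ?_) (ENNReal.ofReal_le_ofReal h)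
    rw [ENNReal.ofReal_sum_of_nonneg fun t _ => by positivity]
    refine Finset.sum_congr rfl fun t _ => ?_
    rw [hcoe _ zero_le_two, hcoe _ hB, ← ENNReal.ofReal_add (by positivity) (by positivity)]
  · rwa [← ENNReal.ofReal_coe_nnreal, ENNReal.ofReal_le_ofReal_iff (by positivity)] at he
  · rwa [← ENNReal.ofReal_coe_nnreal, ENNReal.ofReal_le_ofReal_iff hΔ] at hφ
  · intro t
    have h := hes t
    rw [hcoe _ (by positivity), ← ENNReal.ofReal_coe_nnreal, ← ENNReal.ofReal_coe_nnreal (p := e t),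
      ← ENNReal.ofReal_add (by positivity) (by positivity), ← ENNReal.ofReal_mul (by positivity),
      ← ENNReal.ofReal_mul (by positivity), ← ENNReal.ofReal_add (by positivity) (by positivity),
      ENNReal.ofReal_le_ofReal_iff (by positivity)] at h
    exact h
  · intro t
    have h := hφs t
    rw [hcoe _ hA0.le, hcoe _ (by positivity), ← ENNReal.ofReal_coe_nnreal,
      ← ENNReal.ofReal_coe_nnreal (p := φ t),
      ← ENNReal.ofReal_add (by positivity) (by positivity),
      ← ENNReal.ofReal_add (by positivity) (by positivity),
      ENNReal.ofReal_le_ofReal_iff (by positivity)] at h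
    exact h

/-! ### The output of the method -/

namespace RewardProblem

variable {n : ℕ} {X : Type*} [MeasurableSpace X] {M : RewardProblem n X}
  {U Cg Ch Dg Dh Cw η Δ : ℝ} {θ₀ : EuclideanSpace ℝ (Fin n)}

/-- The factor in front of `Δ` in the bound on the accumulated squared stationarity gaps. -/
noncomputable def gapFactor (U Cg Ch Dg Dh Cw η : ℝ) : ℝ :=
  (2 * constC U Cg Ch Dg Dh Cw + 2 * (constL U Cg Ch Dg Dh + 1 / η) ^ 2) / constL U Cg Ch Dg Dh

/-- The factor in front of the variance of the mini-batch gradients in the bound on the accumulated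
squared stationarity gaps. -/
noncomputable def varianceFactor (U Cg Ch Dg Dh Cw η : ℝ) : ℝ :=
  (2 + gapFactor U Cg Ch Dg Dh Cw η / (2 * constL U Cg Ch Dg Dh)) * (U * Cg + Dg) ^ 2

theorem lintegral_stationarityGap_outputLaw_le (hM : M.WellPosed) (hR : M.BoundedReward U Dg Dh)
    (hS : M.BoundedScore Cg Ch) (hW : M.BoundedImportanceWeight Cw)
    (hU : 0 < U) (hCg : 0 < Cg) (hCh : 0 < Ch) (hDg : 0 < Dg) (hDh : 0 < Dh) (hΔ : 0 < Δ)
    (hη : 0 < η) (hηle : η ≤ constL U Cg Ch Dg Dh /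
      (2 * constC U Cg Ch Dg Dh Cw + 2 * constL U Cg Ch Dg Dh ^ 2))
    (hθ₀ : M.optimalValue - M.objective θ₀ ≤ (Δ : EReal)) {N : ℕ} (hN : N ≠ 0) (T : ℕ) :
    ∫⁻ θ, M.stationarityGap θ ^ 2 ∂M.outputLaw (N ^ 2) N (1 / ((N : ℝ) + 1)) η θ₀ T ≤
      (T : ℝ≥0∞)⁻¹ * ENNReal.ofReal (varianceFactor U Cg Ch Dg Dh Cw η *
        (((N : ℝ) + 1) / (N : ℝ) ^ 2 + T / (N : ℝ) ^ 2) + gapFactor U Cg Ch Dg Dh Cw η * Δ) := by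
  have hLip := norm_gradient_expectedReward_sub_le hM hR hS hU hCg hDg
  have hL : 0 < constL U Cg Ch Dg Dh := by
    unfold constL
    positivity
  have hC : 0 ≤ constC U Cg Ch Dg Dh Cw := by
    unfold constC
    positivity
  have hN' : (0 : ℝ) < N := Nat.cast_pos.2 (Nat.pos_of_ne_zero hN)
  unfold varianceFactor gapFactor
  set L := constL U Cg Ch Dg Dh with hLdef
  set C := constC U Cg Ch Dg Dh Cw with hCdef
  have hp0 : 0 ≤ 1 / ((N : ℝ) + 1) := by positivity
  have hp1 : 1 / ((N : ℝ) + 1) ≤ 1 := (div_le_one (by positivity)).2 (by linarith)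
  have hq : 1 - 1 / ((N : ℝ) + 1) = N / ((N : ℝ) + 1) := by
    field_simp
    ring
  have hA : L + 2 * C / L ≤ 1 / η - L := by
    have h1 : (2 * C + 2 * L ^ 2) / L ≤ 1 / η := by
      rw [le_div_iff₀ (by positivity)] at hηle
      rw [div_le_div_iff₀ hL hη]
      linarith
    have h2 : (2 * C + 2 * L ^ 2) / L = 2 * C / L + 2 * L := by
      field_simp
    linarith
  have hLη : η * L ≤ 1 := by
    have h1 : 0 ≤ 2 * C / L := by positivity
    have h2 : L ≤ 1 / η := by linarith
    rw [le_div_iff₀ hη] at h2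
    linarith
  refine (lintegral_outputLaw_le _ T).trans (mul_le_mul_right ?_ _)
  refine (Finset.sum_le_sum fun t _ =>
    lintegral_stationarityGap_stateLaw_succ_le hM hR hη hLip hp0 hp1 t).trans ?_
  refine (sum_le_of_error_and_descent_recursion_ennreal (N := N) (A := 1 / η - L) (C := C)
    (v := (U * Cg + Dg) ^ 2) (Δ := Δ)
    (φ := M.meanSuboptimality (N ^ 2) N (1 / ((N : ℝ) + 1)) η θ₀)
    hN' hL hC (by positivity) (by positivity) hΔ.le hA ?_
    (meanSuboptimality_zero_le hθ₀ hM) (fun t => ?_)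
    (meanSuboptimality_succ_add_le hM hR hS hη hL hLη hLip hp0 hp1) T).trans_eq ?_
  · have h := meanSqError_zero_le (N₂ := N) (p := 1 / ((N : ℝ) + 1)) (η := η) (θ₀ := θ₀)
      hM hR hS (pow_ne_zero 2 hN)
    rwa [Nat.cast_pow] at h
  · have h := meanSqError_succ_le (θ₀ := θ₀) hM hR hS hW hU hCg hCh hDg hη hp0 hp1
      (pow_ne_zero 2 hN) hN t
    rwa [Nat.cast_pow, hq] at h
  · congr 1
    ring

/-- The batch size `⌈α / ε⌉` and the number `⌈β / ε²⌉` of iterations bring the bound on the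
accumulated squared stationarity gaps below `T ε²`. -/
theorem accumulated_gap_le {P Q α β ε N T : ℝ} (hP : 0 ≤ P) (hε : 0 < ε) (hα : 1 + 2 * P ≤ α)
    (hβ : 4 * P + 2 * Q ≤ β) (hN1 : 1 ≤ N) (hN : α / ε ≤ N) (hT : β / ε ^ 2 ≤ T) (hT0 : 0 ≤ T) :
    P * ((N + 1) / N ^ 2 + T / N ^ 2) + Q ≤ T * ε ^ 2 := by
  rw [div_le_iff₀ hε] at hN
  rw [div_le_iff₀ (by positivity)] at hT
  have hN0 : 0 < N := by linarith
  have h1 : (N + 1) / N ^ 2 ≤ 2 := by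
    rw [div_le_iff₀ (by positivity)]
    nlinarith
  have h2 : P * (T / N ^ 2) ≤ T * ε ^ 2 / 2 := by
    have h3 : 2 * P ≤ (N * ε) ^ 2 := by nlinarith
    rw [← mul_div_assoc, div_le_iff₀ (by positivity)]
    nlinarith [mul_le_mul_of_nonneg_left h3 hT0]
  nlinarith [mul_le_mul_of_nonneg_left h1 hP]

end RewardProblem

theorem mainTheorem1 (U Cg Ch Dg Dh Cw η Δ : ℝ)
    (hU : 0 < U) (hCg : 0 < Cg) (hCh : 0 < Ch) (hDg : 0 < Dg) (hDh : 0 < Dh) (hCw : 0 < Cw)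
    (hΔ : 0 < Δ) (hη : 0 < η)
    (hηle : η ≤ RewardProblem.constL U Cg Ch Dg Dh /
      (2 * RewardProblem.constC U Cg Ch Dg Dh Cw +
        2 * RewardProblem.constL U Cg Ch Dg Dh ^ 2)) :
    ∃ a b : ℝ, 0 < a ∧ 0 < b ∧ ∀ α β : ℝ, a ≤ α → b ≤ β → ∃ c : ℝ, 0 < c ∧
      ∀ (n : ℕ) (X : Type*) [MeasurableSpace X] (M : RewardProblem n X)
        (θ₀ : EuclideanSpace ℝ (Fin n)),
        M.WellPosed → M.BoundedReward U Dg Dh → M.BoundedScore Cg Ch →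
        M.BoundedImportanceWeight Cw →
        M.optimalValue - M.objective θ₀ ≤ (Δ : EReal) →
        Differentiable ℝ M.expectedReward ∧
        ∀ ε : ℝ, 0 < ε → ε < 1 → ∀ (N₁ N₂ T : ℕ) (p : ℝ),
          N₂ = ⌈α / ε⌉₊ → N₁ = N₂ ^ 2 → T = ⌈β / ε ^ 2⌉₊ →
          p = (N₂ : ℝ) / ((N₁ : ℝ) + (N₂ : ℝ)) →
          IsProbabilityMeasure (M.outputLaw N₁ N₂ p η θ₀ T) ∧
          ∫⁻ θ, M.stationarityGap θ ^ 2 ∂M.outputLaw N₁ N₂ p η θ₀ T ≤ ENNReal.ofReal (ε ^ 2) ∧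
          M.expectedSamples N₁ N₂ p η θ₀ T ≤ ENNReal.ofReal (c / ε ^ 3) := by
  have hL : 0 < RewardProblem.constL U Cg Ch Dg Dh := by
    unfold RewardProblem.constL
    positivity
  have hC : 0 < RewardProblem.constC U Cg Ch Dg Dh Cw := by
    unfold RewardProblem.constC
    positivity
  set Q := RewardProblem.gapFactor U Cg Ch Dg Dh Cw η with hQ
  set P := RewardProblem.varianceFactor U Cg Ch Dg Dh Cw η with hP
  have hQ0 : 0 < Q := by
    rw [hQ, RewardProblem.gapFactor]
    positivity
  have hP0 : 0 < P := by
    rw [hP, RewardProblem.varianceFactor, ← hQ]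
    positivity
  refine ⟨1 + 2 * P, 4 * P + 2 * (Q * Δ), by positivity, by positivity, fun α β hα hβ => ?_⟩
  have hα0 : 0 < α := by linarith
  have hβ0 : 0 < β := lt_of_lt_of_le (by positivity) hβ
  refine ⟨(α + 1) ^ 2 + 2 * (β + 1) * (α + 1), by positivity, ?_⟩
  intro n X _ M θ₀ hM hR hS hW hθ₀
  refine ⟨RewardProblem.differentiable_expectedReward hM hR hS, ?_⟩
  rintro ε hε hε1 N₁ N T p hN₂ rfl hT hp
  have hNpos : 0 < N := hN₂ ▸ Nat.ceil_pos.2 (by positivity)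
  have hTpos : 0 < T := hT ▸ Nat.ceil_pos.2 (by positivity)
  have hN1 : (1 : ℝ) ≤ N := Nat.one_le_cast.2 hNpos
  have hp' : p = 1 / ((N : ℝ) + 1) := by
    rw [hp]
    push_cast
    field_simp
  have hp0 : 0 ≤ p := by
    rw [hp']
    positivity
  have hp1 : p ≤ 1 := by
    rw [hp', div_le_one (by positivity)]
    linarith
  refine ⟨RewardProblem.isProbabilityMeasure_outputLaw hM hR hS hη hp0 hp1 θ₀ hTpos.ne', ?_, ?_⟩
  · rw [hp']
    refine (RewardProblem.lintegral_stationarityGap_outputLaw_le hM hR hS hW hU hCg hCh hDg hDh hΔ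
      hη hηle hθ₀ hNpos.ne' T).trans ?_
    have hbound := RewardProblem.accumulated_gap_le hP0.le hε hα hβ hN1 (hN₂ ▸ Nat.le_ceil _)
      (hT ▸ Nat.le_ceil _) (Nat.cast_nonneg T)
    refine (mul_le_mul_right (ENNReal.ofReal_le_ofReal hbound) _).trans_eq ?_
    rw [ENNReal.ofReal_mul (Nat.cast_nonneg T), ENNReal.ofReal_natCast, ← mul_assoc,
      ENNReal.inv_mul_cancel (Nat.cast_ne_zero.2 hTpos.ne') (ENNReal.natCast_ne_top T), one_mul]
  · refine (RewardProblem.expectedSamples_le hM hR hS hη hp0 hp1 T).trans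
      (ENNReal.ofReal_le_ofReal ?_)
    have hNle : (N : ℝ) ≤ (α + 1) / ε := by
      have h1 : (N : ℝ) < α / ε + 1 := hN₂ ▸ Nat.ceil_lt_add_one (by positivity)
      have h2 : 1 ≤ 1 / ε := (one_le_div hε).2 hε1.le
      rw [add_div]
      linarith
    have hTle : (T : ℝ) ≤ (β + 1) / ε ^ 2 := by
      have h1 : (T : ℝ) < β / ε ^ 2 + 1 := hT ▸ Nat.ceil_lt_add_one (by positivity)
      have h2 : 1 ≤ 1 / ε ^ 2 := (one_le_div (by positivity)).2 (pow_le_one₀ hε.le hε1.le)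
      rw [add_div]
      linarith
    -- both branches contribute at most `N` samples per iteration on average
    have hmean : p * ((N ^ 2 : ℕ) : ℝ) + (1 - p) * N ≤ 2 * N := by
      have h1 : p * ((N ^ 2 : ℕ) : ℝ) ≤ N := by
        rw [hp', one_div_mul_eq_div, div_le_iff₀ (by positivity)]
        push_cast
        nlinarith
      nlinarith
    calc ((N ^ 2 : ℕ) : ℝ) + T * (p * ((N ^ 2 : ℕ) : ℝ) + (1 - p) * N)
        ≤ ((α + 1) / ε) ^ 2 + (β + 1) / ε ^ 2 * (2 * ((α + 1) / ε)) := by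
          push_cast at hmean ⊢
          gcongr
          exact hmean.trans (by linarith)
      _ = (α + 1) ^ 2 / ε ^ 2 + 2 * (β + 1) * (α + 1) / ε ^ 3 := by
          field_simp
      _ ≤ (α + 1) ^ 2 / ε ^ 3 + 2 * (β + 1) * (α + 1) / ε ^ 3 := by
          gcongr ?_ + _
          exact div_le_div_of_nonneg_left (by positivity) (by positivity)
            (pow_le_pow_of_le_one hε.le hε1.le (by norm_num))
      _ = _ := by rw [add_div]
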